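/- **Theorem 3.5 (Saturation error in the limit).** For $\varphi\in L^1(\mathbb R^d)\cap L^2(\mathbb R^d)$ (complex valued) let $\hat\varphi(\xi)=(2\pi)^{-d/2}\int_{\mathbb R^d}\varphi(x)e^{-i\langle\xi,x\rangle}\,dx$. For $T,s>0$ and $k\in\mathbb Z^d$ put $\varphi_{T,s}^k(x)=T^{-d/2}\varphi(x/T-sk)$, let $\mathcal V_{T,s,\varphi}$ be the closed linear span of $(\varphi_{T,s}^k)_{k\in\mathbb Z^d}$ in $L^2(\mathbb R^d)$, and let $P_{T,s}$ be the orthogonal projection of $L^2(\mathbb R^d)$ onto $\mathcal V_{T,s,\varphi}$. The family $(\varphi_{T,s}^k)_k$ is called a Riesz basis of $\mathcal V_{T,s,\varphi}$ if there are $A,B>0$ such that for every $c\in\ell^2(\mathbb Z^d)$ the series $\sum_k c_k\varphi_{T,s}^k$ converges unconditionally in $L^2$ and $A\|c\|_{\ell^2}^2\le\|\sum_k c_k\varphi_{T,s}^k\|_{L^2}^2\le B\|c\|_{\ell^2}^2$. For $s>0$ put $$A_{\varphi,s}=\frac{\sum_{k\in\mathbb Z^d,\,k\ne0}|\hat\varphi(2k\pi/s)|^2}{\sum_{k\in\mathbb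 Z^d}|\hat\varphi(2k\pi/s)|^2}.$$ Suppose that $\hat\varphi(\xi)=\mathcal O(\|\xi\|^{-p})$ as $\|\xi\|\to\infty$ for some $p>d/2$. Then the series in the definition of $A_{\varphi,s}$ converge for every $s>0$, and the following hold. 1. Let $s>0$ be such that $(\varphi_{T_0,s}^k)_{k\in\mathbb Z^d}$ is a Riesz basis of $\mathcal V_{T_0,s,\varphi}$ for some $T_0>0$. Then $\sum_{k\in\mathbb Z^d}|\hat\varphi(2k\pi/s)|^2>0$, and for all $r>d/2$ and all $f$ in the $L^2$-Sobolev space $W_2^r(\mathbb R^d)$, $$\lim_{T\to0^+}\|P_{T,s}f-f\|_{L^2}^2=A_{\varphi,s}\,\|f\|_{L^2}^2 .$$ 2. If $\hat\varphi(0)\neq0$, then $\lim_{s\to0^+}A_{\varphi,s}=0$. -/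

import Mathlib

open MeasureTheory Filter Topology
open scoped ENNReal SchwartzMap

noncomputable section

namespace ShiftInvariant

variable {d : ℕ}

/-- The integer vector `k ∈ ℤ^d`, seen as a point of `ℝ^d`. -/
def latticePoint (k : Fin d → ℤ) : EuclideanSpace ℝ (Fin d) :=
  WithLp.toLp 2 (fun i => (k i : ℝ))

/-- The unitary, angular-frequency Fourier transform of an integrable function,
`φ̂(ξ) = (2π)^{-d/2} ∫ φ(x) e^{-i⟨ξ,x⟩} dx`, as a function defined at every point. -/
def fourierHat (φ : EuclideanSpace ℝ (Fin d) → ℂ) (ξ : EuclideanSpace ℝ (Fin d)) : ℂ :=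
  (((2 * Real.pi) ^ (-(d : ℝ) / 2) : ℝ) : ℂ) *
    ∫ x, φ x * Complex.exp (-(Complex.I * ((inner ℝ ξ x : ℝ) : ℂ)))

/-- The function `φ_{T,s}^k(x) = T^{-d/2} φ(x/T - s k)`. -/
def atom (φ : EuclideanSpace ℝ (Fin d) → ℂ) (T s : ℝ) (k : Fin d → ℤ)
    (x : EuclideanSpace ℝ (Fin d)) : ℂ :=
  ((T ^ (-(d : ℝ) / 2) : ℝ) : ℂ) * φ (T⁻¹ • x - s • latticePoint k)

theorem memLp_atom {φ : EuclideanSpace ℝ (Fin d) → ℂ} (hφ : MemLp φ 2 volume) {T : ℝ}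
    (hT : 0 < T) (s : ℝ) (k : Fin d → ℤ) : MemLp (atom φ T s k) 2 volume := by
  have h1 : MemLp (fun x => φ (x - s • latticePoint k)) 2 volume :=
    hφ.comp_measurePreserving (measurePreserving_sub_right volume _)
  have hT' : T⁻¹ ≠ 0 := inv_ne_zero hT.ne'
  have h2 : MemLp (fun x : EuclideanSpace ℝ (Fin d) => φ (T⁻¹ • x - s • latticePoint k))
      2 volume := by
    have h3 : MemLp (fun x => φ (x - s • latticePoint k)) 2
        (Measure.map (fun x : EuclideanSpace ℝ (Fin d) => T⁻¹ • x) volume) := by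
      rw [Measure.map_addHaar_smul volume hT']
      exact h1.smul_measure ENNReal.ofReal_ne_top
    exact h3.comp_of_map (measurable_const_smul _).aemeasurable
  exact h2.const_mul _

open Classical in
/-- The class of `φ_{T,s}^k` in `L²(ℝ^d)`. For `φ ∈ L²` and `T > 0` the function `φ_{T,s}^k` is
in `L²` (`memLp_atom`), and the value `0` of the other branch never occurs. -/
def atomLp (φ : EuclideanSpace ℝ (Fin d) → ℂ) (T s : ℝ) (k : Fin d → ℤ) :
    Lp ℂ 2 (volume : Measure (EuclideanSpace ℝ (Fin d))) :=
  if h : MemLp (atom φ T s k) 2 volume then h.toLp (atom φ T s k) else 0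

theorem coeFn_atomLp {φ : EuclideanSpace ℝ (Fin d) → ℂ} (hφ : MemLp φ 2 volume) {T : ℝ}
    (hT : 0 < T) (s : ℝ) (k : Fin d → ℤ) : atomLp φ T s k =ᵐ[volume] atom φ T s k := by
  rw [atomLp, dif_pos (memLp_atom hφ hT s k)]
  exact MemLp.coeFn_toLp _

/-- The shift invariant space `V_{T,s,φ}`: the closed linear span in `L²(ℝ^d)` of the functions
`φ_{T,s}^k`, `k ∈ ℤ^d`. -/
def shiftSpace (φ : EuclideanSpace ℝ (Fin d) → ℂ) (T s : ℝ) :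
    Submodule ℂ (Lp ℂ 2 (volume : Measure (EuclideanSpace ℝ (Fin d)))) :=
  (Submodule.span ℂ (Set.range (atomLp φ T s))).topologicalClosure

instance (φ : EuclideanSpace ℝ (Fin d) → ℂ) (T s : ℝ) : CompleteSpace (shiftSpace φ T s) :=
  inferInstanceAs (CompleteSpace
    (Submodule.span ℂ (Set.range (atomLp φ T s))).topologicalClosure)

/-- The orthogonal projection `P_{T,s}` of `L²(ℝ^d)` onto `V_{T,s,φ}`. -/
def proj (φ : EuclideanSpace ℝ (Fin d) → ℂ) (T s : ℝ) :
    Lp ℂ 2 (volume : Measure (EuclideanSpace ℝ (Fin d))) →L[ℂ]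
      Lp ℂ 2 (volume : Measure (EuclideanSpace ℝ (Fin d))) :=
  (shiftSpace φ T s).starProjection

/-- `(φ_{T,s}^k)_{k ∈ ℤ^d}` is a Riesz basis of its closed linear span `V_{T,s,φ}`: there are
`A, B > 0` with `A ‖c‖² ≤ ‖∑ₖ cₖ φ_{T,s}^k‖² ≤ B ‖c‖²` for all `c ∈ ℓ²(ℤ^d)`, the series
converging in `L²`. -/
def IsRieszBasis (φ : EuclideanSpace ℝ (Fin d) → ℂ) (T s : ℝ) : Prop :=
  ∃ A B : ℝ, 0 < A ∧ 0 < B ∧ ∀ c : lp (fun _ : Fin d → ℤ => ℂ) 2,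
    Summable (fun k => c k • atomLp φ T s k) ∧
      A * ‖c‖ ^ 2 ≤ ‖∑' k, c k • atomLp φ T s k‖ ^ 2 ∧
      ‖∑' k, c k • atomLp φ T s k‖ ^ 2 ≤ B * ‖c‖ ^ 2

/-- The term `|φ̂(2kπ/s)|²`. -/
def fourierSample (φ : EuclideanSpace ℝ (Fin d) → ℂ) (s : ℝ) (k : Fin d → ℤ) : ℝ :=
  ‖fourierHat φ ((2 * Real.pi / s) • latticePoint k)‖ ^ 2

/-- The saturation error
`A_{φ,s} = (∑_{k ≠ 0} |φ̂(2kπ/s)|²) / (∑_{k ∈ ℤ^d} |φ̂(2kπ/s)|²)`. -/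
def saturation (φ : EuclideanSpace ℝ (Fin d) → ℂ) (s : ℝ) : ℝ :=
  (∑' k : {k : Fin d → ℤ // k ≠ 0}, fourierSample φ s k) / ∑' k : Fin d → ℤ, fourierSample φ s k

end ShiftInvariant

end

/-!
On the Fourier side a finite combination of the atoms `φ_{T,s}^k` is, in the variable
`x = T s ξ/(2π)` that turns the frequencies `2kπ/s` of `A_{φ,s}` into integer points, the product of a
trigonometric polynomial `q` on the torus `(ℝ/ℤ)^d` and the function `ψ(x) = φ̂(2πx/s)`, which
does not depend on `T` (`exists_mFourier_of_mem_span`, `exists_mem_span_of_mFourier`). The same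
change of variable turns the Fourier transform of a fixed `f` into a function `h` that
concentrates at the origin as `T → 0`.

Let `R(x) = ∑_{k ≠ 0} |ψ(x + k)|²`. If `h` is supported near the origin, then unfolding the
integral over the unit cube gives `‖h - q ψ‖² = ∫ |h - q ψ|² + |q|² R` over the cube
(`lintegral_sub_mul_periodic`). Pointwise, the minimum of the integrand over the values of `q` is
`|h|² R / (|ψ|² + R)`, and by the decay of `φ̂` the quotient is continuous at `0`, where its value
is `A_{φ,s}`. This bounds the distance from below (`exists_le_eLpNorm_sub`). The bound is attained
in the limit with the periodization of `a h`, where `a = conj ψ(0) / (|ψ(0)|² + R(0))`; it is a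
limit of trigonometric polynomials in `L²` of the torus for the image of the measure `|ψ|² dx`
(`exists_eLpNorm_sub_le`). Functions with compactly supported Fourier transform are dense in `L²`,
and the distances are `1`-Lipschitz in `f`, so the limit for a dense set of
`f` gives it for all `f ∈ L²` (`tendsto_norm_sub_proj`).

The Riesz basis property enters only through `|ψ(0)|² + R(0) > 0`: Parseval's identity turns the
lower Riesz bound into an inequality between two measures on the torus, which fails on small
neighbourhoods of `0` if the sum vanishes (`total_energy_pos`). The limit `s → 0` is a direct
estimate from the decay of `φ̂` (`tendsto_saturation`).
-/

noncomputable section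

namespace ShiftInvariant

variable {d : ℕ}

open FourierTransform Complex UnitAddTorus

/-! ### Fourier transforms of the atoms -/

theorem continuous_fourier {f : EuclideanSpace ℝ (Fin d) → ℂ} (hf : Integrable f volume) :
    Continuous (𝓕 f) :=
  VectorFourier.fourierIntegral_continuous Real.continuous_fourierChar
    (innerSL ℝ).continuous₂ hf

/-- For `f ∈ L¹ ∩ L²`, the Fourier transform of the class of `f` in `L²` is represented by the
integral transform of `f`: both define the same tempered distribution. -/
theorem fourier_toLp_ae_eq {f : EuclideanSpace ℝ (Fin d) → ℂ} (hf₁ : Integrable f volume)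
    (hf₂ : MemLp f 2 volume) : (𝓕 (hf₂.toLp f) : Lp ℂ 2 volume) =ᵐ[volume] 𝓕 f := by
  refine ae_eq_of_integral_contDiff_smul_eq ((Lp.memLp _).locallyIntegrable one_le_two)
    (continuous_fourier hf₁).locallyIntegrable fun g hg hgc => ?_
  have hc : HasCompactSupport (Complex.ofRealCLM ∘ g) := hgc.comp_left rfl
  have hs : ContDiff ℝ (⊤ : ℕ∞) (Complex.ofRealCLM ∘ g) := by fun_prop
  set G : 𝓢(EuclideanSpace ℝ (Fin d), ℂ) := hc.toSchwartzMap hs with hG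
  have h1 := congrArg (fun u : 𝓢'(EuclideanSpace ℝ (Fin d), ℂ) => u G)
    (Lp.fourier_toTemperedDistribution_eq (hf₂.toLp f))
  simp only [TemperedDistribution.fourier_apply, Lp.toTemperedDistribution_apply] at h1
  have h2 : ∫ x, (𝓕 G) x • (hf₂.toLp f) x = ∫ x, (𝓕 G) x • f x := by
    refine integral_congr_ae ?_
    filter_upwards [hf₂.coeFn_toLp] with x hx
    rw [hx]
  have h3 : ∫ x, (𝓕 G) x • f x = ∫ x, G x • 𝓕 f x := by
    simpa using! (VectorFourier.integral_fourierIntegral_smul_eq_flip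
      (L := innerₗ (EuclideanSpace ℝ (Fin d))) Real.continuous_fourierChar continuous_inner
      (G.integrable (μ := volume)) hf₁)
  have h4 : ∀ x, G x = (g x : ℂ) := fun x => rfl
  simp only [h4, h2, h3] at h1
  simpa using h1.symm

theorem fourierHat_eq (φ : EuclideanSpace ℝ (Fin d) → ℂ) (ξ : EuclideanSpace ℝ (Fin d)) :
    fourierHat φ ξ =
      (((2 * Real.pi) ^ (-(d : ℝ) / 2) : ℝ) : ℂ) * 𝓕 φ ((2 * Real.pi)⁻¹ • ξ) := by
  rw [fourierHat, Real.fourier_eq']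
  congr 1
  refine integral_congr_ae (Eventually.of_forall fun x => ?_)
  have hpi : (Real.pi : ℂ) ≠ 0 := by exact_mod_cast Real.pi_ne_zero
  simp only [inner_smul_right, smul_eq_mul]
  rw [mul_comm, real_inner_comm]
  congr 2
  push_cast
  field_simp

theorem continuous_fourierHat {φ : EuclideanSpace ℝ (Fin d) → ℂ} (hφ : Integrable φ volume) :
    Continuous (fourierHat φ) := by
  have : fourierHat φ = fun ξ => (((2 * Real.pi) ^ (-(d : ℝ) / 2) : ℝ) : ℂ) *
      𝓕 φ ((2 * Real.pi)⁻¹ • ξ) := funext (fourierHat_eq φ)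
  rw [this]
  exact continuous_const.mul ((continuous_fourier hφ).comp (continuous_const_smul _))

/-- The Fourier transform of `φ` on the scale on which the frequencies `2kπ/s` are the integer
points. -/
def scaledHat (φ : EuclideanSpace ℝ (Fin d) → ℂ) (s : ℝ) (x : EuclideanSpace ℝ (Fin d)) : ℂ :=
  fourierHat φ ((2 * Real.pi / s) • x)

theorem scaledHat_zero (φ : EuclideanSpace ℝ (Fin d) → ℂ) (s : ℝ) :
    scaledHat φ s 0 = fourierHat φ 0 := by
  rw [scaledHat, smul_zero]

theorem continuous_scaledHat {φ : EuclideanSpace ℝ (Fin d) → ℂ} (hφ : Integrable φ volume)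
    (s : ℝ) : Continuous (scaledHat φ s) :=
  (continuous_fourierHat hφ).comp (continuous_const_smul _)

/-- The scalar in the Fourier transform of an atom; it depends on neither the translation nor the
frequency. -/
def atomFactor (d : ℕ) (T : ℝ) : ℝ :=
  T ^ (-(d : ℝ) / 2) * T ^ d * (2 * Real.pi) ^ ((d : ℝ) / 2)

theorem atomFactor_pos (d : ℕ) {T : ℝ} (hT : 0 < T) : 0 < atomFactor d T := by
  unfold atomFactor; positivity

/-- The quotient map `ℝ^d → (ℝ/ℤ)^d`. -/
def toTorus (x : EuclideanSpace ℝ (Fin d)) : UnitAddTorus (Fin d) := fun i => (x i : UnitAddCircle)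

theorem mFourier_toTorus (n : Fin d → ℤ) (x : EuclideanSpace ℝ (Fin d)) :
    mFourier n (toTorus x) = exp (2 * Real.pi * I * (inner ℝ (latticePoint n) x : ℝ)) := by
  simp only [mFourier, toTorus, ContinuousMap.coe_mk, fourier_coe_apply, latticePoint,
    PiLp.inner_apply, ← Complex.exp_sum]
  congr 1
  push_cast
  rw [Finset.mul_sum]
  refine Finset.sum_congr rfl fun i _ => ?_
  simp
  ring

theorem latticePoint_zero : latticePoint (0 : Fin d → ℤ) = 0 := by
  ext i; simp [latticePoint]

theorem latticePoint_neg (k : Fin d → ℤ) : latticePoint (-k) = -latticePoint k := by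
  ext i; simp [latticePoint]

/-- The Fourier transform turns the translation in an atom into a character of the torus, evaluated
at the rescaled frequency `T s ξ`. -/
theorem fourier_atom (φ : EuclideanSpace ℝ (Fin d) → ℂ) {T s : ℝ} (hT : 0 < T) (hs : 0 < s)
    (k : Fin d → ℤ) (ξ : EuclideanSpace ℝ (Fin d)) :
    𝓕 (atom φ T s k) ξ = (atomFactor d T : ℂ) *
      (mFourier (-k) (toTorus ((T * s) • ξ)) * scaledHat φ s ((T * s) • ξ)) := by
  have h2 : (2 * Real.pi)⁻¹ • (2 * Real.pi / s) • (T * s) • ξ = T • ξ := by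
    rw [smul_smul, smul_smul]; congr 1; field_simp
  rw [scaledHat, fourierHat_eq, h2, Real.fourier_eq', Real.fourier_eq']
  set F : EuclideanSpace ℝ (Fin d) → ℂ := fun u =>
    mFourier (-k) (toTorus ((T * s) • ξ)) *
      (((T ^ (-(d : ℝ) / 2) : ℝ) : ℂ) * (exp (↑(-2 * Real.pi * inner ℝ u (T • ξ)) * I) • φ u))
    with hF
  -- The integrand is `F` after the affine substitution `u = T⁻¹ v - s k`.
  have h3 : ∀ v, exp (↑(-2 * Real.pi * inner ℝ v ξ) * I) • atom φ T s k v =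
      F (T⁻¹ • v - s • latticePoint k) := by
    intro v
    simp only [hF, mFourier_toTorus, atom, smul_eq_mul]
    rw [show ∀ a b c : ℂ, a * (b * c) = a * b * c from fun a b c => (mul_assoc a b c).symm,
      show ∀ a b c e : ℂ, a * (b * (c * e)) = (a * c) * b * e from fun a b c e => by ring,
      ← Complex.exp_add]
    congr 3
    rw [inner_sub_left, inner_smul_left, inner_smul_left, inner_smul_right, inner_smul_right,
      inner_smul_right, latticePoint_neg, inner_neg_left]
    have hT' : (T : ℂ) ≠ 0 := by exact_mod_cast hT.ne'
    simp only [conj_trivial]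
    push_cast
    field_simp
    ring
  simp_rw [h3]
  rw [Measure.integral_comp_smul volume (fun u => F (u - s • latticePoint k)),
    integral_sub_right_eq_self F]
  simp only [hF, integral_const_mul, finrank_euclideanSpace, Fintype.card_fin]
  rw [inv_pow, inv_inv, abs_of_pos (pow_pos hT d), real_smul]
  have h4 : ((2 * Real.pi) ^ ((d : ℝ) / 2) : ℝ) * (2 * Real.pi) ^ (-(d : ℝ) / 2) = 1 := by
    rw [← Real.rpow_add (by positivity)]
    simp [neg_div]
  have h5 : ((((2 * Real.pi) ^ ((d : ℝ) / 2) : ℝ) : ℂ)) * (((2 * Real.pi) ^ (-(d : ℝ) / 2) : ℝ) : ℂ)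
      = 1 := by exact_mod_cast h4
  rw [atomFactor, ofReal_mul, ofReal_mul]
  linear_combination (-(↑(T ^ (-(d : ℝ) / 2)) * ↑(T ^ d) * mFourier (-k) (toTorus ((T * s) • ξ)) *
    ∫ (v : EuclideanSpace ℝ (Fin d)), exp (↑(-2 * Real.pi * inner ℝ v (T • ξ)) * I) • φ v)) * h5

theorem integrable_atom {φ : EuclideanSpace ℝ (Fin d) → ℂ} (hφ : Integrable φ volume) {T : ℝ}
    (hT : 0 < T) (s : ℝ) (k : Fin d → ℤ) : Integrable (atom φ T s k) volume := by
  have h := (hφ.comp_sub_right (s • latticePoint k)).comp_smul (inv_ne_zero hT.ne')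
  exact h.const_mul _

theorem fourier_atomLp {φ : EuclideanSpace ℝ (Fin d) → ℂ} (hφ₁ : Integrable φ volume)
    (hφ₂ : MemLp φ 2 volume) {T s : ℝ} (hT : 0 < T) (hs : 0 < s) (k : Fin d → ℤ) :
    (𝓕 (atomLp φ T s k) : Lp ℂ 2 volume) =ᵐ[volume] fun ξ =>
      (atomFactor d T : ℂ) *
      (mFourier (-k) (toTorus ((T * s) • ξ)) * scaledHat φ s ((T * s) • ξ)) := by
  rw [atomLp, dif_pos (memLp_atom hφ₂ hT s k)]
  filter_upwards [fourier_toLp_ae_eq (integrable_atom hφ₁ hT s k) (memLp_atom hφ₂ hT s k)]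
    with ξ hξ
  rw [hξ, fourier_atom φ hT hs]

/-! ### Integration and approximation on the torus -/

theorem measurable_toTorus : Measurable (toTorus (d := d)) :=
  measurable_pi_lambda _ fun i => AddCircle.measurable_mk'.comp (by fun_prop)

theorem toTorus_add_latticePoint (x : EuclideanSpace ℝ (Fin d)) (k : Fin d → ℤ) :
    toTorus (x + latticePoint k) = toTorus x := by
  ext i
  simp only [toTorus, latticePoint, PiLp.add_apply, AddCircle.coe_add]
  rw [add_eq_left, AddCircle.coe_eq_zero_iff]
  exact ⟨k i, by simp⟩

/-- The centred unit cube `(-1/2, 1/2]^d`, a fundamental domain for `ℤ^d`. -/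
def unitCell (d : ℕ) : Set (EuclideanSpace ℝ (Fin d)) :=
  {x | ∀ i, x i ∈ Set.Ioc (-(1 / 2) : ℝ) (-(1 / 2) + 1)}

theorem measurableSet_unitCell : MeasurableSet (unitCell d) := by
  have : unitCell d = ⋂ i, (fun x : EuclideanSpace ℝ (Fin d) => x i) ⁻¹'
      Set.Ioc (-(1 / 2) : ℝ) (-(1 / 2) + 1) := by
    ext x; simp [unitCell]
  rw [this]
  exact MeasurableSet.iInter fun i => (by fun_prop : Measurable fun x : EuclideanSpace ℝ (Fin d) =>
    x i) measurableSet_Ioc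

theorem eq_of_sub_latticePoint_mem {x : EuclideanSpace ℝ (Fin d)} {k l : Fin d → ℤ}
    (hk : x - latticePoint k ∈ unitCell d) (hl : x - latticePoint l ∈ unitCell d) : k = l := by
  ext i
  have h1 := hk i
  have h2 := hl i
  simp only [latticePoint, PiLp.sub_apply, Set.mem_Ioc] at h1 h2
  have h3 : (k i : ℝ) < l i + 1 := by linarith
  have h4 : (l i : ℝ) < k i + 1 := by linarith
  norm_cast at h3 h4
  omega

theorem exists_sub_latticePoint_mem (x : EuclideanSpace ℝ (Fin d)) :
    ∃ k : Fin d → ℤ, x - latticePoint k ∈ unitCell d := by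
  refine ⟨fun i => ⌈x i - 1 / 2⌉, fun i => ?_⟩
  have h1 := Int.le_ceil (x i - 1 / 2)
  have h2 := Int.ceil_lt_add_one (x i - 1 / 2)
  simp only [latticePoint, PiLp.sub_apply, Set.mem_Ioc]
  constructor <;> linarith

theorem mem_unitCell_of_norm_lt {x : EuclideanSpace ℝ (Fin d)} (hx : ‖x‖ < 1 / 2) :
    x ∈ unitCell d := by
  intro i
  have h := (PiLp.norm_apply_le x i).trans_lt hx
  rw [Real.norm_eq_abs, abs_lt] at h
  constructor <;> linarith [h.1, h.2]

/-- An integral over `ℝ^d` is the integral over the unit cube of the periodization. -/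
theorem lintegral_eq_unitCell {G : EuclideanSpace ℝ (Fin d) → ℝ≥0∞} (hG : Measurable G) :
    ∫⁻ x, G x = ∫⁻ x in unitCell d, ∑' k : Fin d → ℤ, G (x + latticePoint k) := by
  have hm : ∀ k : Fin d → ℤ, MeasurableSet ((fun x => x - latticePoint k) ⁻¹' unitCell d) :=
    fun k => (measurable_id.sub_const _) measurableSet_unitCell
  have hU : ⋃ k : Fin d → ℤ, (fun x => x - latticePoint k) ⁻¹' unitCell d = Set.univ :=
    Set.iUnion_eq_univ_iff.2 exists_sub_latticePoint_mem
  have hGk : ∀ k : Fin d → ℤ, Measurable fun x => G (x + latticePoint k) :=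
    fun k => hG.comp (measurable_id.add_const _)
  rw [lintegral_tsum fun k => (hGk k).aemeasurable, ← setLIntegral_univ, ← hU, lintegral_iUnion hm]
  · refine tsum_congr fun k => ?_
    rw [← (measurePreserving_sub_right volume (latticePoint k)).setLIntegral_comp_preimage
      measurableSet_unitCell (hGk k)]
    simp
  · intro k l hkl
    refine Set.disjoint_left.2 fun x hk hl => hkl (eq_of_sub_latticePoint_mem hk hl)

/-- The representative in the centred unit cube of a point of the torus. -/
def cellRep (t : UnitAddTorus (Fin d)) : EuclideanSpace ℝ (Fin d) :=
  WithLp.toLp 2 fun i => (AddCircle.equivIoc 1 (-(1 / 2) : ℝ) (t i) : ℝ)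

theorem measurable_cellRep : Measurable (cellRep (d := d)) := by
  refine (WithLp.measurable_toLp 2 _).comp (measurable_pi_lambda _ fun i => ?_)
  exact measurable_subtype_coe.comp
    ((AddCircle.measurableEquivIoc 1 (-(1 / 2) : ℝ)).measurable.comp (measurable_pi_apply i))

theorem cellRep_toTorus {x : EuclideanSpace ℝ (Fin d)} (hx : x ∈ unitCell d) :
    cellRep (toTorus x) = x := by
  ext i
  exact congrArg Subtype.val (AddCircle.equivIoc_coe_eq (hx i))

/-- Trigonometric polynomials are dense in `L²` of the torus for every finite measure, not only for
the Haar measure. -/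
theorem exists_span_mFourier_eLpNorm_sub_le (μ : Measure (UnitAddTorus (Fin d)))
    [IsFiniteMeasure μ] {m : UnitAddTorus (Fin d) → ℂ} (hm : MemLp m 2 μ) {ε : ℝ≥0∞}
    (hε : ε ≠ 0) :
    ∃ q ∈ Submodule.span ℂ (Set.range (mFourier (d := Fin d))),
      eLpNorm (fun t => m t - q t) 2 μ ≤ ε := by
  have h :=
    (ContinuousMap.toLp_denseRange ℂ μ ℂ (p := 2) (by simp)).topologicalClosure_map_submodule
      (span_mFourier_closure_eq_top (d := Fin d))
  have h1 : hm.toLp m ∈ closure ((Submodule.map (ContinuousMap.toLp 2 μ ℂ).toLinearMap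
    (Submodule.span ℂ (Set.range (mFourier (d := Fin d))))) : Set (Lp ℂ 2 μ)) := by
    rw [← Submodule.topologicalClosure_coe, h]
    trivial
  obtain ⟨_, ⟨q, hq, rfl⟩, hd⟩ := EMetric.mem_closure_iff.1 h1 ε hε.bot_lt
  refine ⟨q, hq, ?_⟩
  rw [Lp.edist_def] at hd
  refine (eLpNorm_congr_ae ?_).trans_le hd.le
  filter_upwards [hm.coeFn_toLp, ContinuousMap.coeFn_toLp (p := 2) (𝕜 := ℂ) μ q] with x h1 h2
  simp only [Pi.sub_apply, h1]
  rw [← h2]; rfl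

theorem eLpNorm_two_sq {α : Type*} [MeasurableSpace α] (μ : Measure α) (f : α → ℂ) :
    eLpNorm f 2 μ ^ 2 = ∫⁻ x, ‖f x‖ₑ ^ 2 ∂μ := by
  have := eLpNorm_nnreal_pow_eq_lintegral (f := f) (μ := μ) (p := 2) two_ne_zero
  simpa using! this

section Parseval
-- The orthonormality of the characters in Mathlib refers to this instance, whose volume is the
-- normalized Haar measure of the circle.
attribute [local instance] instMeasureSpaceUnitAddCircle

/-- Parseval's identity for trigonometric polynomials, as an integral over the unit cube. -/
theorem lintegral_unitCell_mFourier (F : Finset (Fin d → ℤ)) (c : (Fin d → ℤ) → ℂ) :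
    ∫⁻ x in unitCell d, ‖(∑ k ∈ F, c k • mFourier k) (toTorus x)‖ₑ ^ 2 =
      ENNReal.ofReal (∑ k ∈ F, ‖c k‖ ^ 2) := by
  have h1 := lintegral_preimage (d := Fin d)
    (fun t => ‖(∑ k ∈ F, c k • mFourier k) t‖ₑ ^ 2) (fun _ => -(1 / 2))
  have h2 : ∫⁻ x in unitCell d, ‖(∑ k ∈ F, c k • mFourier k) (toTorus x)‖ₑ ^ 2 =
      ∫⁻ (x : Fin d → ℝ) in {x | ∀ i, x i ∈ Set.Ioc (-(1 / 2) : ℝ) (-(1 / 2) + 1)},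
        ‖(∑ k ∈ F, c k • mFourier k) fun i => (x i : UnitAddCircle)‖ₑ ^ 2 := by
    rw [← (PiLp.volume_preserving_ofLp (Fin d)).setLIntegral_comp_preimage_emb
      (MeasurableEquiv.toLp 2 (Fin d → ℝ)).symm.measurableEmbedding]
    rfl
  rw [h2, ← h1, ← eLpNorm_two_sq]
  have : IsProbabilityMeasure (volume : Measure UnitAddCircle) :=
    inferInstanceAs (IsProbabilityMeasure AddCircle.haarAddCircle)
  set q : C(UnitAddTorus (Fin d), ℂ) := ∑ k ∈ F, c k • mFourier k with hq
  have h3 : ContinuousMap.toLp (E := ℂ) 2 volume ℂ q = ∑ k ∈ F, c k • mFourierLp 2 k := by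
    simp [hq, map_sum]
  have h4 := (orthonormal_mFourier (d := Fin d)).inner_sum c c F
  rw [← h3, inner_self_eq_norm_sq_to_K] at h4
  have h5 : ‖ContinuousMap.toLp (E := ℂ) 2 volume ℂ q‖ ^ 2 = ∑ k ∈ F, ‖c k‖ ^ 2 := by
    have : ∀ z : ℂ, (starRingEnd ℂ) z * z = ((‖z‖ ^ 2 : ℝ) : ℂ) := fun z => by
      rw [mul_comm, Complex.mul_conj, Complex.normSq_eq_norm_sq]
    simp only [this] at h4
    refine Complex.ofReal_injective ?_
    rw [Complex.ofReal_sum, ← h4]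
    simp
  rw [← h5, ENNReal.ofReal_pow (norm_nonneg _), ofReal_norm, Lp.enorm_def]
  congr 1
  exact (eLpNorm_congr_ae (ContinuousMap.coeFn_toLp (p := 2) (𝕜 := ℂ) volume q)).symm
end Parseval

/-! ### Aliases of a decaying function -/

theorem enorm_sq_eq (z : ℂ) : ‖z‖ₑ ^ 2 = ENNReal.ofReal (‖z‖ ^ 2) := by
  rw [ENNReal.ofReal_pow (norm_nonneg _), ofReal_norm]

theorem sq_mul_rpow_neg (C p : ℝ) {t : ℝ} (ht : 0 ≤ t) :
    (C * t ^ (-p)) ^ 2 = C ^ 2 * t ^ (-(2 * p)) := by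
  rw [mul_pow, ← Real.rpow_natCast, ← Real.rpow_natCast, ← Real.rpow_mul ht]
  congr 2; push_cast; ring

theorem summable_one_add_norm_latticePoint {r : ℝ} (hr : (d : ℝ) < r) :
    Summable fun k : Fin d → ℤ => (1 + ‖latticePoint k‖) ^ (-r) := by
  set b := (EuclideanSpace.basisFun (Fin d) ℝ).toBasis with hb
  set L := Submodule.span ℤ (Set.range b) with hL
  have hmem : ∀ k : Fin d → ℤ, latticePoint k ∈ L := by
    intro k
    have : latticePoint k = ∑ i, k i • b i := by
      ext j
      simp [latticePoint, hb, Finset.sum_apply, Pi.single_apply]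
    rw [this]
    exact Submodule.sum_mem _ fun i _ =>
      Submodule.smul_mem _ _ (Submodule.subset_span (Set.mem_range_self i))
  have hinj : Function.Injective fun k : Fin d → ℤ => (⟨latticePoint k, hmem k⟩ : L) := by
    intro k l hkl
    ext i
    have := congrArg (fun x : L => (x : EuclideanSpace ℝ (Fin d)) i) hkl
    simpa [latticePoint] using this
  have hrank : Module.finrank ℤ L = d := by
    rw [ZLattice.rank ℝ L]; simp
  have hs := (ZLattice.summable_norm_rpow L (-r) (by rw [hrank]; linarith)).comp_injective hinj
  refine Summable.of_norm_bounded_eventually hs ?_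
  refine (Set.finite_singleton (0 : Fin d → ℤ)).subset fun k hk => ?_
  by_contra hk0
  refine hk ?_
  have hpos : 0 < ‖latticePoint k‖ := by
    rw [norm_pos_iff]
    intro h0
    refine hk0 ?_
    ext i
    have := congrArg (fun x : EuclideanSpace ℝ (Fin d) => x i) h0
    simpa [latticePoint] using this
  have hr0 : 0 ≤ r := (Nat.cast_nonneg d).trans hr.le
  change ‖(1 + ‖latticePoint k‖) ^ (-r)‖ ≤ ‖latticePoint k‖ ^ (-r)
  rw [Real.norm_of_nonneg (by positivity)]
  exact Real.rpow_le_rpow_of_nonpos hpos (by linarith) (by linarith)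

/-- For a continuous function, polynomial decay at infinity is a global bound. -/
theorem exists_decay_bound {ψ : EuclideanSpace ℝ (Fin d) → ℂ} (hψ : Continuous ψ) {p : ℝ}
    (hp : 0 < p)
    (h : ψ =O[Bornology.cobounded (EuclideanSpace ℝ (Fin d))] fun ξ => ‖ξ‖ ^ (-p)) :
    ∃ C, ∀ x, ‖ψ x‖ ≤ C * (1 + ‖x‖) ^ (-p) := by
  obtain ⟨c, hc⟩ := h.bound
  have hc' := hc.and (eventually_cobounded_le_norm (1 : ℝ))
  rw [Metric.cobounded_eq_cocompact] at hc'
  obtain ⟨K, hK, hKc⟩ := hasBasis_cocompact.eventually_iff.1 hc'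
  have hcont : ContinuousOn (fun x => ‖ψ x‖ * (1 + ‖x‖) ^ p) K := by
    refine (hψ.norm.mul ?_).continuousOn
    exact (continuous_const.add continuous_norm).rpow_const fun x => Or.inr hp.le
  obtain ⟨M, hM⟩ := hK.bddAbove_image hcont
  refine ⟨max M (|c| * 2 ^ p), fun x => ?_⟩
  have hx1 : 0 < 1 + ‖x‖ := by positivity
  rw [Real.rpow_neg hx1.le, ← div_eq_mul_inv, le_div_iff₀ (by positivity)]
  by_cases hx : x ∈ K
  · exact (hM (Set.mem_image_of_mem _ hx)).trans (le_max_left _ _)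
  · obtain ⟨h1, h2⟩ := hKc hx
    refine le_trans ?_ (le_max_right _ _)
    have hxp : 0 < ‖x‖ := by linarith
    have h3 : (1 + ‖x‖) ^ p ≤ 2 ^ p * ‖x‖ ^ p := by
      rw [← Real.mul_rpow (by norm_num) hxp.le]
      exact Real.rpow_le_rpow hx1.le (by linarith) hp.le
    rw [Real.norm_of_nonneg (by positivity : 0 ≤ ‖x‖ ^ (-p)), Real.rpow_neg hxp.le] at h1
    calc ‖ψ x‖ * (1 + ‖x‖) ^ p ≤ (|c| * (‖x‖ ^ p)⁻¹) * (2 ^ p * ‖x‖ ^ p) := by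
          refine mul_le_mul (h1.trans ?_) h3 (by positivity) (by positivity)
          gcongr
          exact le_abs_self c
      _ = |c| * 2 ^ p := by
          field_simp

section Model

variable {ψ : EuclideanSpace ℝ (Fin d) → ℂ} {p C : ℝ}

theorem memLp_two_of_decay (hψc : Continuous ψ) (hp : (d : ℝ) / 2 < p)
    (hψ : ∀ x, ‖ψ x‖ ≤ C * (1 + ‖x‖) ^ (-p)) : MemLp ψ 2 volume := by
  rw [memLp_two_iff_integrable_sq_norm hψc.aestronglyMeasurable]
  have h := (integrable_one_add_norm (E := EuclideanSpace ℝ (Fin d)) (μ := volume) (r := 2 * p)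
    (by simp; linarith)).const_mul (C ^ 2)
  refine h.mono' (hψc.norm.pow 2).aestronglyMeasurable (Eventually.of_forall fun x => ?_)
  rw [Real.norm_of_nonneg (by positivity)]
  calc ‖ψ x‖ ^ 2 ≤ (C * (1 + ‖x‖) ^ (-p)) ^ 2 := by gcongr; exact hψ x
    _ = C ^ 2 * (1 + ‖x‖) ^ (-(2 * p)) :=
      sq_mul_rpow_neg C p (by positivity)

theorem sq_norm_add_latticePoint_le (hp : 0 < p) (hψ : ∀ x, ‖ψ x‖ ≤ C * (1 + ‖x‖) ^ (-p))
    {x : EuclideanSpace ℝ (Fin d)} (hx : ‖x‖ ≤ 1) (k : Fin d → ℤ) :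
    ‖ψ (x + latticePoint k)‖ ^ 2 ≤ C ^ 2 * 2 ^ (2 * p) * (1 + ‖latticePoint k‖) ^ (-(2 * p)) := by
  set y := x + latticePoint k with hy
  have h1 : ‖latticePoint k‖ ≤ ‖y‖ + 1 := by
    have : latticePoint k = y - x := by rw [hy]; abel
    rw [this]
    exact (norm_sub_le _ _).trans (by linarith)
  calc ‖ψ y‖ ^ 2 ≤ (C * (1 + ‖y‖) ^ (-p)) ^ 2 := by gcongr; exact hψ y
    _ = C ^ 2 * (1 + ‖y‖) ^ (-(2 * p)) :=
      sq_mul_rpow_neg C p (by positivity)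
    _ ≤ C ^ 2 * ((1 + ‖latticePoint k‖) / 2) ^ (-(2 * p)) := by
      gcongr ?_ * ?_
      exact Real.rpow_le_rpow_of_nonpos (by positivity)
        (by linarith [norm_nonneg y]) (by linarith)
    _ = _ := by
      rw [Real.div_rpow (by positivity) (by norm_num), Real.rpow_neg (by norm_num : (0:ℝ) ≤ 2)]
      field_simp

/-- The energy `∑_{k ≠ 0} |ψ(x + k)|²` of `ψ` at the aliases of the frequency `x`, that is, at the
points other than `x` that agree with `x` modulo `ℤ^d`. -/
def aliasEnergy (ψ : EuclideanSpace ℝ (Fin d) → ℂ) (x : EuclideanSpace ℝ (Fin d)) : ℝ :=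
  ∑' k : {k : Fin d → ℤ // k ≠ 0}, ‖ψ (x + latticePoint k)‖ ^ 2

theorem aliasEnergy_nonneg (ψ : EuclideanSpace ℝ (Fin d) → ℂ) (x : EuclideanSpace ℝ (Fin d)) :
    0 ≤ aliasEnergy ψ x := tsum_nonneg fun _ => by positivity

theorem summable_sq_norm_add_latticePoint (hp : (d : ℝ) / 2 < p)
    (hψ : ∀ x, ‖ψ x‖ ≤ C * (1 + ‖x‖) ^ (-p)) {x : EuclideanSpace ℝ (Fin d)} (hx : ‖x‖ ≤ 1) :
    Summable fun k : Fin d → ℤ => ‖ψ (x + latticePoint k)‖ ^ 2 := by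
  have hp0 : 0 < p := lt_of_le_of_lt (by positivity) hp
  exact Summable.of_nonneg_of_le (fun _ => by positivity)
    (sq_norm_add_latticePoint_le hp0 hψ hx)
    ((summable_one_add_norm_latticePoint (r := 2 * p) (by linarith)).mul_left _)

theorem continuousAt_aliasEnergy (hψc : Continuous ψ) (hp : (d : ℝ) / 2 < p)
    (hψ : ∀ x, ‖ψ x‖ ≤ C * (1 + ‖x‖) ^ (-p)) : ContinuousAt (aliasEnergy ψ) 0 := by
  have hp0 : 0 < p := lt_of_le_of_lt (by positivity) hp
  have hs := ((summable_one_add_norm_latticePoint (d := d) (r := 2 * p) (by linarith)).mul_left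
    (C ^ 2 * 2 ^ (2 * p))).subtype {k | k ≠ 0}
  have : ContinuousOn (aliasEnergy ψ) (Metric.closedBall 0 1) := by
    refine continuousOn_tsum (fun k => ?_) hs fun k x hx => ?_
    · exact ((hψc.comp (continuous_id.add continuous_const)).norm.pow 2).continuousOn
    · rw [Real.norm_of_nonneg (by positivity)]
      exact sq_norm_add_latticePoint_le hp0 hψ (mem_closedBall_zero_iff.1 hx) k
  exact this.continuousAt (Metric.closedBall_mem_nhds _ one_pos)

theorem tsum_enorm_sq_ne_zero (hp : (d : ℝ) / 2 < p)
    (hψ : ∀ x, ‖ψ x‖ ≤ C * (1 + ‖x‖) ^ (-p)) {x : EuclideanSpace ℝ (Fin d)} (hx : ‖x‖ ≤ 1) :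
    ∑' k : {k : Fin d → ℤ // k ≠ 0}, ‖ψ (x + latticePoint k)‖ₑ ^ 2 =
      ENNReal.ofReal (aliasEnergy ψ x) := by
  have hs : Summable fun k : {k : Fin d → ℤ // k ≠ 0} => ‖ψ (x + latticePoint k)‖ ^ 2 :=
    (summable_sq_norm_add_latticePoint hp hψ hx).subtype {k | k ≠ 0}
  rw [aliasEnergy, ENNReal.ofReal_tsum_of_nonneg (fun _ => by positivity) hs]
  exact tsum_congr fun k => enorm_sq_eq _

/-- The squared `L²` distance from `h`, supported in the unit cube, to the product of a periodic
function and `ψ`. Only the frequency in the cube can be matched to `h`; the aliases contribute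
`|m|²` times their energy. -/
theorem lintegral_sub_mul_periodic (hψc : Continuous ψ) {h : EuclideanSpace ℝ (Fin d) → ℂ}
    (hh : Measurable h) (hsupp : ∀ x, 1 / 2 ≤ ‖x‖ → h x = 0) {m : UnitAddTorus (Fin d) → ℂ}
    (hm : Measurable m) :
    ∫⁻ x, ‖h x - m (toTorus x) * ψ x‖ₑ ^ 2 = ∫⁻ x in unitCell d,
      (‖h x - m (toTorus x) * ψ x‖ₑ ^ 2 + ‖m (toTorus x)‖ₑ ^ 2 *
        ∑' k : {k : Fin d → ℤ // k ≠ 0}, ‖ψ (x + latticePoint k)‖ₑ ^ 2) := by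
  have hmeas : Measurable fun x => ‖h x - m (toTorus x) * ψ x‖ₑ ^ 2 :=
    ((hh.sub ((hm.comp measurable_toTorus).mul hψc.measurable)).enorm).pow_const 2
  rw [lintegral_eq_unitCell hmeas]
  refine setLIntegral_congr_fun measurableSet_unitCell fun x hx => ?_
  rw [ENNReal.tsum_eq_add_tsum_ite 0, ← ENNReal.tsum_mul_left]
  congr 1
  · simp [latticePoint_zero]
  · refine Eq.trans ?_ (tsum_subtype {k : Fin d → ℤ | k ≠ 0}
      fun k => ‖m (toTorus x)‖ₑ ^ 2 * ‖ψ (x + latticePoint k)‖ₑ ^ 2).symm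
    refine tsum_congr fun k => ?_
    by_cases hk : k = 0
    · simp [hk]
    · rw [if_neg hk, Set.indicator_of_mem (by exact hk), toTorus_add_latticePoint]
      have h0 : h (x + latticePoint k) = 0 := by
        refine hsupp _ ?_
        by_contra hlt
        have h1 := mem_unitCell_of_norm_lt (not_le.1 hlt)
        refine hk (eq_of_sub_latticePoint_mem (x := x + latticePoint k) (k := k) (l := 0) ?_ ?_)
        · simpa using hx
        · simpa [latticePoint_zero] using h1
      rw [h0, zero_sub, enorm_neg, enorm_mul, mul_pow]

end Model

/-! ### Approximation by periodic multiples of a fixed function -/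

section Model

variable {ψ : EuclideanSpace ℝ (Fin d) → ℂ} {p C : ℝ}

/-- The minimum over `m` of `|h - m ψ|² + |m|² R` is `R |h|² / (|ψ|² + R)`; this is the lower
bound. -/
theorem sq_mul_div_le (h m ψ : ℂ) {R : ℝ} (hR : 0 ≤ R) :
    R / (‖ψ‖ ^ 2 + R) * ‖h‖ ^ 2 ≤ ‖h - m * ψ‖ ^ 2 + ‖m‖ ^ 2 * R := by
  rcases (by positivity : 0 ≤ ‖ψ‖ ^ 2 + R).eq_or_lt with h0 | h0
  · rw [← h0]; simp; positivity
  rw [div_mul_eq_mul_div, div_le_iff₀ h0]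
  have h1 : (‖h‖ - ‖m‖ * ‖ψ‖) ^ 2 ≤ ‖h - m * ψ‖ ^ 2 := by
    rw [← norm_mul]
    exact sq_le_sq' (by linarith [norm_sub_norm_le (m * ψ) h, norm_sub_rev h (m * ψ)])
      (norm_sub_norm_le _ _)
  -- After multiplication by `|ψ|² + R`, the two sides differ by this square.
  have h2 : 0 ≤ (‖h‖ * ‖ψ‖ - ‖m‖ * (‖ψ‖ ^ 2 + R)) ^ 2 := sq_nonneg _
  nlinarith [mul_le_mul_of_nonneg_right h1 h0.le]

theorem mul_le_of_sq_le {a : ℝ} {x y : ℝ≥0∞} (h : ENNReal.ofReal a ^ 2 * x ^ 2 ≤ y ^ 2) :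
    ENNReal.ofReal a * x ≤ y := by
  rw [← mul_pow] at h
  exact (ENNReal.pow_le_pow_left_iff two_ne_zero).1 h

theorem lintegral_enorm_sq_eq_unitCell {h : EuclideanSpace ℝ (Fin d) → ℂ}
    (hsupp : ∀ x, 1 / 2 ≤ ‖x‖ → h x = 0) :
    ∫⁻ x, ‖h x‖ₑ ^ 2 = ∫⁻ x in unitCell d, ‖h x‖ₑ ^ 2 := by
  refine (setLIntegral_eq_of_support_subset fun x hx => mem_unitCell_of_norm_lt ?_).symm
  by_contra hlt
  exact hx (by simp [hsupp x (not_lt.1 hlt)])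

/-- A function supported near the origin keeps, up to `ε`, the relative distance
`√(R(0) / (|ψ(0)|² + R(0)))` from all products of `ψ` with a periodic function, where `R` is the
alias energy. -/
theorem exists_le_eLpNorm_sub (hψc : Continuous ψ) (hp : (d : ℝ) / 2 < p)
    (hψ : ∀ x, ‖ψ x‖ ≤ C * (1 + ‖x‖) ^ (-p)) (hpos : 0 < ‖ψ 0‖ ^ 2 + aliasEnergy ψ 0)
    {ε : ℝ} (hε : 0 < ε) :
    ∃ δ > 0, ∀ h : EuclideanSpace ℝ (Fin d) → ℂ, Measurable h → (∀ x, δ ≤ ‖x‖ → h x = 0) →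
      ∀ m : UnitAddTorus (Fin d) → ℂ, Measurable m →
        ENNReal.ofReal (√(aliasEnergy ψ 0 / (‖ψ 0‖ ^ 2 + aliasEnergy ψ 0)) - ε) *
          eLpNorm h 2 volume ≤ eLpNorm (fun x => h x - m (toTorus x) * ψ x) 2 volume := by
  have hc : ContinuousAt (fun x => √(aliasEnergy ψ x / (‖ψ x‖ ^ 2 + aliasEnergy ψ x))) 0 :=
    ((continuousAt_aliasEnergy hψc hp hψ).div ((hψc.continuousAt.norm.pow 2).add
      (continuousAt_aliasEnergy hψc hp hψ)) hpos.ne').sqrt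
  obtain ⟨δ, hδ, hball⟩ := Metric.eventually_nhds_iff.1
    (hc.eventually (lt_mem_nhds (sub_lt_self _ hε)))
  refine ⟨min δ (1 / 2), by positivity, fun h hh hsupp m hm => mul_le_of_sq_le ?_⟩
  have hsupp' : ∀ x, 1 / 2 ≤ ‖x‖ → h x = 0 := fun x hx => hsupp x ((min_le_right _ _).trans hx)
  rw [eLpNorm_two_sq, eLpNorm_two_sq, lintegral_sub_mul_periodic hψc hh hsupp' hm,
    lintegral_enorm_sq_eq_unitCell hsupp', ← lintegral_const_mul _ (hh.enorm.pow_const 2)]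
  refine lintegral_mono fun x => ?_
  dsimp only
  by_cases hx : ‖x‖ < min δ (1 / 2)
  · have hx1 : ‖x‖ ≤ 1 := by linarith [hx.trans_le (min_le_right _ _)]
    have h1 := (hball (y := x) (by simpa using hx.trans_le (min_le_left _ _))).le
    rw [tsum_enorm_sq_ne_zero hp hψ hx1]
    have hR := aliasEnergy_nonneg ψ x
    calc _ ≤ ENNReal.ofReal (√(aliasEnergy ψ x / (‖ψ x‖ ^ 2 + aliasEnergy ψ x))) ^ 2
          * ‖h x‖ₑ ^ 2 := by gcongr
      _ = ENNReal.ofReal (aliasEnergy ψ x / (‖ψ x‖ ^ 2 + aliasEnergy ψ x) * ‖h x‖ ^ 2) := by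
        rw [← ENNReal.ofReal_pow (Real.sqrt_nonneg _), Real.sq_sqrt (by positivity), enorm_sq_eq,
          ENNReal.ofReal_mul (by positivity)]
      _ ≤ ENNReal.ofReal (‖h x - m (toTorus x) * ψ x‖ ^ 2 +
            ‖m (toTorus x)‖ ^ 2 * aliasEnergy ψ x) :=
        ENNReal.ofReal_le_ofReal (sq_mul_div_le _ _ _ hR)
      _ = _ := by
        rw [ENNReal.ofReal_add (by positivity) (by positivity), ENNReal.ofReal_mul (by positivity),
          enorm_sq_eq, enorm_sq_eq]
  · rw [hsupp x (not_lt.1 hx)]; simp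

/-- The measure on the torus for which the `L²` norm of `q` is the norm in `L²(ℝ^d)` of the product
of `ψ` and the periodic function given by `q`: the image of `|ψ|² dx`. -/
def torusMeasure (ψ : EuclideanSpace ℝ (Fin d) → ℂ) : Measure (UnitAddTorus (Fin d)) :=
  (volume.withDensity fun x => ‖ψ x‖ₑ ^ 2).map toTorus

theorem isFiniteMeasure_torusMeasure (hψ : MemLp ψ 2 volume) :
    IsFiniteMeasure (torusMeasure ψ) := by
  have : IsFiniteMeasure (volume.withDensity fun x => ‖ψ x‖ₑ ^ 2) := by
    refine isFiniteMeasure_withDensity ?_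
    rw [← eLpNorm_two_sq]
    exact ENNReal.pow_ne_top hψ.eLpNorm_ne_top
  exact Measure.isFiniteMeasure_map _ _

theorem eLpNorm_torusMeasure (hψc : Continuous ψ) {g : UnitAddTorus (Fin d) → ℂ}
    (hg : Measurable g) :
    eLpNorm g 2 (torusMeasure ψ) = eLpNorm (fun x => g (toTorus x) * ψ x) 2 volume := by
  refine (ENNReal.pow_right_strictMono two_ne_zero).injective ?_
  rw [eLpNorm_two_sq, eLpNorm_two_sq, torusMeasure,
    lintegral_map (hg.enorm.pow_const 2) measurable_toTorus,
    lintegral_withDensity_eq_lintegral_mul _ (hψc.measurable.enorm.pow_const 2)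
      (g := fun x => ‖g (toTorus x)‖ₑ ^ 2) ((hg.comp measurable_toTorus).enorm.pow_const 2)]
  refine lintegral_congr fun x => ?_
  simp only [Pi.mul_apply, enorm_mul, mul_pow, mul_comm]

/-- The multiplier `conj z / (|z|² + R)` attains the minimum of `|1 - a z|² + |a|² R`. -/
theorem normSq_sub_add_eq (z : ℂ) {R : ℝ} (hR : 0 < ‖z‖ ^ 2 + R) :
    ‖1 - (starRingEnd ℂ z / (‖z‖ ^ 2 + R : ℝ)) * z‖ ^ 2 +
      ‖starRingEnd ℂ z / (‖z‖ ^ 2 + R : ℝ)‖ ^ 2 * R = R / (‖z‖ ^ 2 + R) := by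
  have h1 : 1 - (starRingEnd ℂ z / (‖z‖ ^ 2 + R : ℝ)) * z = ((R / (‖z‖ ^ 2 + R) : ℝ) : ℂ) := by
    have h2 : ((‖z‖ ^ 2 + R : ℝ) : ℂ) ≠ 0 := by exact_mod_cast hR.ne'
    have h3 : starRingEnd ℂ z * z = ((‖z‖ ^ 2 : ℝ) : ℂ) := by
      rw [mul_comm, Complex.mul_conj, Complex.normSq_eq_norm_sq]
    rw [div_mul_eq_mul_div, h3, Complex.ofReal_div, eq_div_iff h2, sub_mul, div_mul_cancel₀ _ h2]
    push_cast; ring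
  rw [h1, norm_div, Complex.norm_conj, Complex.norm_real, Complex.norm_real, Real.norm_eq_abs,
    Real.norm_eq_abs, sq_abs, div_pow, div_pow, sq_abs]
  field_simp
  ring

/-- A continuous function `h` supported near the origin is approximated, with the relative error
`√(R(0) / (|ψ(0)|² + R(0))) + ε`, by a product of `ψ` and a trigonometric polynomial. The polynomial
approximates the periodization of `a h`, with `a` the optimal multiplier at the frequency `0`. -/
theorem exists_eLpNorm_sub_le (hψc : Continuous ψ) (hp : (d : ℝ) / 2 < p)
    (hψ : ∀ x, ‖ψ x‖ ≤ C * (1 + ‖x‖) ^ (-p)) (hpos : 0 < ‖ψ 0‖ ^ 2 + aliasEnergy ψ 0)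
    {ε : ℝ} (hε : 0 < ε) :
    ∃ δ > 0, ∀ h : EuclideanSpace ℝ (Fin d) → ℂ, Continuous h → (∀ x, δ ≤ ‖x‖ → h x = 0) →
      ∀ η : ℝ≥0∞, η ≠ 0 → ∃ q ∈ Submodule.span ℂ (Set.range (mFourier (d := Fin d))),
        eLpNorm (fun x => h x - q (toTorus x) * ψ x) 2 volume ≤
        ENNReal.ofReal (√(aliasEnergy ψ 0 / (‖ψ 0‖ ^ 2 + aliasEnergy ψ 0)) + ε) *
          eLpNorm h 2 volume + η := by
  set a : ℂ := starRingEnd ℂ (ψ 0) / (‖ψ 0‖ ^ 2 + aliasEnergy ψ 0 : ℝ) with ha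
  have hc : ContinuousAt (fun x => √(‖1 - a * ψ x‖ ^ 2 + ‖a‖ ^ 2 * aliasEnergy ψ x)) 0 := by
    refine ContinuousAt.sqrt (((continuousAt_const.sub
      (continuousAt_const.mul hψc.continuousAt)).norm.pow 2).add
      (continuousAt_const.mul (continuousAt_aliasEnergy hψc hp hψ)))
  have hc0 : √(‖1 - a * ψ 0‖ ^ 2 + ‖a‖ ^ 2 * aliasEnergy ψ 0) <
      √(aliasEnergy ψ 0 / (‖ψ 0‖ ^ 2 + aliasEnergy ψ 0)) + ε := by
    rw [ha, normSq_sub_add_eq _ hpos]; linarith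
  obtain ⟨δ, hδ, hball⟩ := Metric.eventually_nhds_iff.1 (hc.eventually (gt_mem_nhds hc0))
  refine ⟨min δ (1 / 2), by positivity, fun h hh hsupp η hη => ?_⟩
  have hsupp' : ∀ x, 1 / 2 ≤ ‖x‖ → h x = 0 := fun x hx => hsupp x ((min_le_right _ _).trans hx)
  set m : UnitAddTorus (Fin d) → ℂ := fun t => a * h (cellRep t) with hm
  have hmm : Measurable m := (hh.measurable.comp measurable_cellRep).const_mul a
  have hfin := isFiniteMeasure_torusMeasure (memLp_two_of_decay hψc hp hψ)
  have hcs : HasCompactSupport h := by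
    refine HasCompactSupport.intro (isCompact_closedBall 0 (1 / 2)) fun x hx => hsupp' x ?_
    simpa using (not_le.1 (by simpa using hx)).le
  obtain ⟨B, hB⟩ := hcs.exists_bound_of_continuous hh
  have hmLp : MemLp m 2 (torusMeasure ψ) := by
    refine MemLp.of_bound hmm.aestronglyMeasurable (‖a‖ * B) (Eventually.of_forall fun t => ?_)
    rw [norm_mul]
    gcongr
    exact hB _
  obtain ⟨q, hq, hmq⟩ := exists_span_mFourier_eLpNorm_sub_le (torusMeasure ψ) hmLp hη
  refine ⟨q, hq, ?_⟩
  have hqm : Measurable q := q.continuous.measurable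
  rw [eLpNorm_torusMeasure hψc (g := fun t => m t - q t) (hmm.sub hqm)] at hmq
  have h1 : eLpNorm (fun x => h x - m (toTorus x) * ψ x) 2 volume ≤
      ENNReal.ofReal (√(aliasEnergy ψ 0 / (‖ψ 0‖ ^ 2 + aliasEnergy ψ 0)) + ε) *
          eLpNorm h 2 volume := by
    refine (ENNReal.pow_le_pow_left_iff two_ne_zero).1 ?_
    rw [mul_pow, eLpNorm_two_sq, eLpNorm_two_sq,
      lintegral_sub_mul_periodic hψc hh.measurable hsupp' hmm,
      lintegral_enorm_sq_eq_unitCell hsupp',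
      ← lintegral_const_mul _ (hh.measurable.enorm.pow_const 2)]
    refine setLIntegral_mono' measurableSet_unitCell fun x hxQ => ?_
    simp only [hm, cellRep_toTorus hxQ]
    by_cases hx : ‖x‖ < min δ (1 / 2)
    · have hx1 : ‖x‖ ≤ 1 := by linarith [hx.trans_le (min_le_right _ _)]
      have h1 := (hball (y := x) (by simpa using hx.trans_le (min_le_left _ _))).le
      rw [tsum_enorm_sq_ne_zero hp hψ hx1]
      have hR := aliasEnergy_nonneg ψ x
      calc _ = ENNReal.ofReal (‖h x - a * h x * ψ x‖ ^ 2 +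
            ‖a * h x‖ ^ 2 * aliasEnergy ψ x) := by
            rw [ENNReal.ofReal_add (by positivity) (by positivity),
              ENNReal.ofReal_mul (by positivity), enorm_sq_eq, enorm_sq_eq]
        _ = ENNReal.ofReal ((‖1 - a * ψ x‖ ^ 2 + ‖a‖ ^ 2 * aliasEnergy ψ x) * ‖h x‖ ^ 2) := by
            congr 1
            rw [show h x - a * h x * ψ x = (1 - a * ψ x) * h x by ring, norm_mul, norm_mul]
            ring
        _ = ENNReal.ofReal √(‖1 - a * ψ x‖ ^ 2 + ‖a‖ ^ 2 * aliasEnergy ψ x) ^ 2 * ‖h x‖ₑ ^ 2 := by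
            rw [← ENNReal.ofReal_pow (Real.sqrt_nonneg _), Real.sq_sqrt (by positivity),
              enorm_sq_eq, ENNReal.ofReal_mul (by positivity)]
        _ ≤ _ := by gcongr
    · rw [hsupp x (not_lt.1 hx)]; simp
  calc eLpNorm (fun x => h x - q (toTorus x) * ψ x) 2 volume
      = eLpNorm ((fun x => h x - m (toTorus x) * ψ x) +
          fun x => (m (toTorus x) - q (toTorus x)) * ψ x) 2 volume := by
        congr 1; ext x; simp only [Pi.add_apply]; ring
    _ ≤ _ := eLpNorm_add_le
        ((hh.measurable.sub ((hmm.comp measurable_toTorus).mul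
          hψc.measurable)).aestronglyMeasurable)
        ((((hmm.comp measurable_toTorus).sub (hqm.comp measurable_toTorus)).mul
          hψc.measurable).aestronglyMeasurable) one_le_two
    _ ≤ _ := add_le_add h1 hmq

/-- An inequality between the `L²` norms of trigonometric polynomials for two finite measures on the
torus is an inequality between the measures. -/
theorem le_of_eLpNorm_span_mFourier_le {μ ν : Measure (UnitAddTorus (Fin d))} [IsFiniteMeasure μ]
    [IsFiniteMeasure ν] (h : ∀ q ∈ Submodule.span ℂ (Set.range (mFourier (d := Fin d))),
      eLpNorm q 2 μ ≤ eLpNorm q 2 ν) : μ ≤ ν := by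
  refine Measure.le_iff.2 fun S hS => ?_
  -- The indicator of `S` is approximated by one polynomial in both norms, through `μ + ν`.
  set m : UnitAddTorus (Fin d) → ℂ := S.indicator 1 with hm
  have hmm : Measurable m := measurable_one.indicator hS
  have hsq : ∀ ρ : Measure (UnitAddTorus (Fin d)), eLpNorm m 2 ρ ^ 2 = ρ S := by
    intro ρ
    rw [eLpNorm_two_sq, ← lintegral_indicator_one hS]
    refine lintegral_congr fun t => ?_
    by_cases ht : t ∈ S <;> simp [hm, ht]
  rw [← hsq, ← hsq]
  refine (ENNReal.pow_le_pow_left_iff two_ne_zero).2 ?_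
  refine ENNReal.le_of_forall_pos_le_add fun ε hε _ => ?_
  have hmLp : MemLp m 2 (μ + ν) := (memLp_const (1 : ℂ)).indicator hS
  obtain ⟨q, hq, hmq⟩ := exists_span_mFourier_eLpNorm_sub_le (μ + ν) hmLp
    (ε := ((ε / 2 : NNReal) : ℝ≥0∞)) (by simpa using hε.ne')
  have hqm : Measurable q := q.continuous.measurable
  have h1 := (eLpNorm_mono_measure (fun t => m t - q t) (p := 2)
    (Measure.le_add_right (le_refl μ) : μ ≤ μ + ν)).trans hmq
  have h2 := (eLpNorm_mono_measure (fun t => m t - q t) (p := 2)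
    (Measure.le_add_left (le_refl ν) : ν ≤ μ + ν)).trans hmq
  calc eLpNorm m 2 μ = eLpNorm ((fun t => q t) + fun t => m t - q t) 2 μ := by
        congr 1; ext t; simp
    _ ≤ eLpNorm q 2 μ + eLpNorm (fun t => m t - q t) 2 μ :=
        eLpNorm_add_le hqm.aestronglyMeasurable (hmm.sub hqm).aestronglyMeasurable one_le_two
    _ ≤ eLpNorm q 2 ν + ↑(ε / 2) := add_le_add (h q hq) h1
    _ = eLpNorm (m - fun t => m t - q t) 2 ν + ↑(ε / 2) := by
        congr 2; ext t; simp
    _ ≤ (eLpNorm m 2 ν + eLpNorm (fun t => m t - q t) 2 ν) + ↑(ε / 2) := by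
        gcongr
        exact eLpNorm_sub_le hmm.aestronglyMeasurable (hmm.sub hqm).aestronglyMeasurable one_le_two
    _ ≤ (eLpNorm m 2 ν + ↑(ε / 2)) + ↑(ε / 2) := by gcongr
    _ = eLpNorm m 2 ν + ε := by
        rw [add_assoc, ← ENNReal.coe_add, add_halves]

/-- A lower Riesz bound forces the total energy `∑ₖ |ψ(k)|²` to be positive: otherwise the
continuous function `∑ₖ |ψ(x + k)|²` is smaller than the bound near `0`, which contradicts the
bound for functions concentrated there. -/
theorem total_energy_pos (hψc : Continuous ψ) (hp : (d : ℝ) / 2 < p)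
    (hψ : ∀ x, ‖ψ x‖ ≤ C * (1 + ‖x‖) ^ (-p)) {a : ℝ} (ha : 0 < a)
    (h : ∀ q ∈ Submodule.span ℂ (Set.range (mFourier (d := Fin d))),
      ENNReal.ofReal a * ∫⁻ x in unitCell d, ‖q (toTorus x)‖ₑ ^ 2 ≤
        ∫⁻ x, ‖q (toTorus x) * ψ x‖ₑ ^ 2) :
    0 < ‖ψ 0‖ ^ 2 + aliasEnergy ψ 0 := by
  have hR0 := aliasEnergy_nonneg ψ 0
  by_contra hneg
  have hc : ContinuousAt (fun x => ‖ψ x‖ ^ 2 + aliasEnergy ψ x) 0 :=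
    (hψc.continuousAt.norm.pow 2).add (continuousAt_aliasEnergy hψc hp hψ)
  obtain ⟨δ₀, hδ₀, hball⟩ := Metric.eventually_nhds_iff.1
    (hc.eventually (gt_mem_nhds (lt_of_le_of_lt (not_lt.1 hneg) (half_pos ha))))
  set δ := min δ₀ (1 / 2) with hδ
  have hδpos : 0 < δ := by positivity
  have hcell : volume (unitCell d) = 1 := by
    simpa [mFourier_zero] using lintegral_unitCell_mFourier (d := d) {0} 1
  have : IsFiniteMeasure (volume.restrict (unitCell d)) := ⟨by simp [hcell]⟩
  have := isFiniteMeasure_torusMeasure (memLp_two_of_decay hψc hp hψ)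
  set μ : Measure (UnitAddTorus (Fin d)) :=
    ENNReal.ofReal a • (volume.restrict (unitCell d)).map toTorus with hμ
  have : IsFiniteMeasure μ := Measure.smul_finite _ ENNReal.ofReal_ne_top
  have hle : μ ≤ torusMeasure ψ := by
    refine le_of_eLpNorm_span_mFourier_le fun q hq => ?_
    have hqm : Measurable q := q.continuous.measurable
    rw [eLpNorm_torusMeasure hψc hqm]
    refine (ENNReal.pow_le_pow_left_iff two_ne_zero).1 ?_
    rw [eLpNorm_two_sq, eLpNorm_two_sq, hμ, lintegral_smul_measure,
      lintegral_map (hqm.enorm.pow_const 2) measurable_toTorus]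
    exact h q hq
  set S : Set (UnitAddTorus (Fin d)) := {t | ‖cellRep t‖ < δ} with hS
  have hSm : MeasurableSet S := measurableSet_lt measurable_cellRep.norm measurable_const
  have hpre : toTorus ⁻¹' S ∩ unitCell d = Metric.ball 0 δ := by
    ext x
    constructor
    · rintro ⟨hx, hxQ⟩
      simpa [hS, cellRep_toTorus hxQ] using hx
    · intro hx
      have hx' : ‖x‖ < δ := by simpa using hx
      have hxQ := mem_unitCell_of_norm_lt (hx'.trans_le (min_le_right _ _))
      exact ⟨by simpa [hS, cellRep_toTorus hxQ] using hx', hxQ⟩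
  have hV0 : volume (Metric.ball (0 : EuclideanSpace ℝ (Fin d)) δ) ≠ 0 :=
    (Metric.measure_ball_pos volume 0 hδpos).ne'
  have hVt : volume (Metric.ball (0 : EuclideanSpace ℝ (Fin d)) δ) ≠ ∞ := measure_ball_lt_top.ne
  have h1 : μ S = ENNReal.ofReal a * volume (Metric.ball (0 : EuclideanSpace ℝ (Fin d)) δ) := by
    rw [hμ, Measure.smul_apply, Measure.map_apply measurable_toTorus hSm,
      Measure.restrict_apply (measurable_toTorus hSm), hpre, smul_eq_mul]
  have h2 : torusMeasure ψ S ≤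
      ENNReal.ofReal (a / 2) * volume (Metric.ball (0 : EuclideanSpace ℝ (Fin d)) δ) := by
    have hmm : Measurable (S.indicator 1 : UnitAddTorus (Fin d) → ℂ) :=
      measurable_one.indicator hSm
    have h3 : torusMeasure ψ S =
        ∫⁻ x, ‖(0 : ℂ) - (S.indicator 1 : UnitAddTorus (Fin d) → ℂ) (toTorus x) * ψ x‖ₑ ^ 2 := by
      simp only [zero_sub, enorm_neg]
      rw [← eLpNorm_two_sq, ← eLpNorm_torusMeasure hψc hmm, eLpNorm_two_sq,
        ← lintegral_indicator_one hSm]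
      refine lintegral_congr fun t => ?_
      by_cases ht : t ∈ S <;> simp [ht]
    rw [h3, lintegral_sub_mul_periodic hψc measurable_const (fun _ _ => rfl) hmm,
      ← lintegral_indicator_one measurableSet_ball, ← lintegral_const_mul _
        (measurable_one.indicator measurableSet_ball), ← lintegral_indicator measurableSet_unitCell]
    refine lintegral_mono fun x => ?_
    dsimp only
    by_cases hx : x ∈ Metric.ball (0 : EuclideanSpace ℝ (Fin d)) δ
    · have hx' : ‖x‖ < δ := by simpa using hx
      have hx1 : ‖x‖ ≤ 1 := by linarith [hx'.trans_le (min_le_right _ _)]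
      have hxS := hpre.symm.subset hx
      rw [Set.indicator_of_mem hx, Set.indicator_of_mem hxS.2,
        Set.indicator_of_mem (show toTorus x ∈ S from hxS.1), tsum_enorm_sq_ne_zero hp hψ hx1]
      have h4 := (hball (y := x) (by simpa using hx'.trans_le (min_le_left _ _))).le
      have hR := aliasEnergy_nonneg ψ x
      simp only [Pi.one_apply, one_mul, zero_sub, enorm_neg, enorm_one, one_pow, mul_one]
      rw [enorm_sq_eq, ← ENNReal.ofReal_add (by positivity) hR]
      exact ENNReal.ofReal_le_ofReal h4
    · by_cases hxQ : x ∈ unitCell d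
      · have hxS : toTorus x ∉ S := fun hxS => hx (hpre.subset ⟨hxS, hxQ⟩)
        simp [hxQ, hxS]
      · simp [hxQ]
  have h5 := (h1.symm.le.trans (hle S)).trans h2
  rw [ENNReal.mul_le_mul_iff_left hV0 hVt, ENNReal.ofReal_le_ofReal_iff (by positivity)] at h5
  linarith

end Model

/-! ### The saturation error -/

section Hat

variable {φ : EuclideanSpace ℝ (Fin d) → ℂ} {p C s : ℝ}

theorem exists_dilate_bound {ψ : EuclideanSpace ℝ (Fin d) → ℂ} (hp : 0 < p)
    (hψ : ∀ x, ‖ψ x‖ ≤ C * (1 + ‖x‖) ^ (-p)) {c : ℝ} (hc : 0 < c) :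
    ∃ C', ∀ x, ‖ψ (c • x)‖ ≤ C' * (1 + ‖x‖) ^ (-p) := by
  have hC : 0 ≤ C := by simpa using (norm_nonneg _).trans (hψ 0)
  refine ⟨C * min 1 c ^ (-p), fun x => (hψ _).trans ?_⟩
  have hm : 0 < min 1 c := lt_min one_pos hc
  rw [mul_assoc, ← Real.mul_rpow hm.le (by positivity), norm_smul, Real.norm_of_nonneg hc.le]
  gcongr ?_ * ?_
  refine Real.rpow_le_rpow_of_nonpos (by positivity) ?_ (by linarith)
  rw [mul_add, mul_one]
  exact add_le_add (min_le_left _ _) (by gcongr; exact min_le_right _ _)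

theorem tsum_eq_zero_add_aliasEnergy {ψ : EuclideanSpace ℝ (Fin d) → ℂ}
    (hs : Summable fun k : Fin d → ℤ => ‖ψ (latticePoint k)‖ ^ 2) :
    ∑' k : Fin d → ℤ, ‖ψ (latticePoint k)‖ ^ 2 = ‖ψ 0‖ ^ 2 + aliasEnergy ψ 0 := by
  rw [hs.tsum_eq_add_tsum_ite 0, aliasEnergy]
  congr 1
  · rw [latticePoint_zero]
  · refine Eq.trans ?_ (tsum_subtype {k : Fin d → ℤ | k ≠ 0}
      fun k => ‖ψ (0 + latticePoint k)‖ ^ 2).symm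
    refine tsum_congr fun k => ?_
    by_cases hk : k = 0
    · simp [hk]
    · rw [if_neg hk, Set.indicator_of_mem (by exact hk), zero_add]

theorem fourierSample_eq (k : Fin d → ℤ) :
    fourierSample φ s k = ‖scaledHat φ s (latticePoint k)‖ ^ 2 := rfl

theorem tsum_fourierSample (hs : Summable (fourierSample φ s)) :
    ∑' k : Fin d → ℤ, fourierSample φ s k =
      ‖scaledHat φ s 0‖ ^ 2 + aliasEnergy (scaledHat φ s) 0 :=
  tsum_eq_zero_add_aliasEnergy (ψ := scaledHat φ s) hs

theorem saturation_eq (hs : Summable (fourierSample φ s)) :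
    saturation φ s = aliasEnergy (scaledHat φ s) 0 /
      (‖scaledHat φ s 0‖ ^ 2 + aliasEnergy (scaledHat φ s) 0) := by
  rw [← tsum_fourierSample hs]
  simp only [saturation, aliasEnergy, zero_add, fourierSample_eq]

theorem saturation_nonneg (hs : Summable (fourierSample φ s)) : 0 ≤ saturation φ s := by
  rw [saturation_eq hs]
  exact div_nonneg (aliasEnergy_nonneg _ _)
    (add_nonneg (by positivity) (aliasEnergy_nonneg _ _))

theorem saturation_le_one (hs : Summable (fourierSample φ s)) : saturation φ s ≤ 1 := by
  rw [saturation_eq hs]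
  exact div_le_one_of_le₀ (le_add_of_nonneg_left (by positivity))
    (add_nonneg (by positivity) (aliasEnergy_nonneg _ _))

/-- As `s → 0`, all nonzero frequencies `2kπ/s` go to infinity, and the decay of `φ̂` makes the
numerator of the saturation error `O(s^{2p})`. -/
theorem tendsto_saturation (hp : (d : ℝ) / 2 < p)
    (hφ : ∀ x, ‖fourierHat φ x‖ ≤ C * (1 + ‖x‖) ^ (-p))
    (hs : ∀ s, 0 < s → Summable (fourierSample φ s)) (h0 : fourierHat φ 0 ≠ 0) :
    Tendsto (saturation φ) (𝓝[>] 0) (𝓝 0) := by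
  have hp0 : 0 < p := lt_of_le_of_lt (by positivity) hp
  have hsum := summable_one_add_norm_latticePoint (d := d) (r := 2 * p) (by linarith)
  set M := ∑' k : {k : Fin d → ℤ // k ≠ 0},
    (1 + ‖latticePoint (k : Fin d → ℤ)‖) ^ (-(2 * p)) with hM
  have hb : 0 < ‖fourierHat φ 0‖ ^ 2 := by positivity
  have hlim : Tendsto (fun s : ℝ => C ^ 2 * s ^ (2 * p) * M / ‖fourierHat φ 0‖ ^ 2) (𝓝[>] 0)
      (𝓝 0) := by
    have h1 : Tendsto (fun s : ℝ => s ^ (2 * p)) (𝓝[>] 0) (𝓝 0) := by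
      have := (Real.continuousAt_rpow_const 0 (2 * p) (Or.inr (by positivity))).tendsto
      rw [Real.zero_rpow (by positivity)] at this
      exact this.mono_left nhdsWithin_le_nhds
    simpa using ((h1.const_mul (C ^ 2)).mul_const M).div_const (‖fourierHat φ 0‖ ^ 2)
  refine tendsto_of_tendsto_of_tendsto_of_le_of_le' tendsto_const_nhds hlim ?_ ?_
  · filter_upwards with s
    exact div_nonneg (tsum_nonneg fun _ => by unfold fourierSample; positivity)
      (tsum_nonneg fun _ => by unfold fourierSample; positivity)
  · filter_upwards [self_mem_nhdsWithin] with s hs0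
    have hs0 : 0 < s := hs0
    rw [saturation_eq (hs s hs0), scaledHat_zero]
    have hR := aliasEnergy_nonneg (scaledHat φ s) 0
    refine div_le_div₀ (by positivity) ?_ hb (le_add_of_nonneg_right hR)
    rw [aliasEnergy, hM, ← tsum_mul_left]
    refine Summable.tsum_le_tsum (fun k => ?_) ?_ ((hsum.subtype {k | k ≠ 0}).mul_left _)
    · rw [zero_add, scaledHat]
      -- A nonzero lattice point has norm at least `1`, hence `2π |k| ≥ 1 + |k|`.
      have hk1 : 1 ≤ ‖latticePoint (k : Fin d → ℤ)‖ := by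
        obtain ⟨i, hi⟩ := Function.ne_iff.1 k.2
        refine le_trans ?_ (PiLp.norm_apply_le (latticePoint (k : Fin d → ℤ)) i)
        simp only [latticePoint, Real.norm_eq_abs]
        exact_mod_cast Int.one_le_abs hi
      have hle : s⁻¹ * (1 + ‖latticePoint (k : Fin d → ℤ)‖) ≤
          1 + ‖(2 * Real.pi / s) • latticePoint (k : Fin d → ℤ)‖ := by
        rw [norm_smul, Real.norm_of_nonneg (by positivity), div_eq_inv_mul, mul_assoc]
        refine le_trans ?_ (le_add_of_nonneg_left zero_le_one)
        gcongr
        nlinarith [Real.pi_gt_three]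
      calc _ ≤ (C * (1 + ‖(2 * Real.pi / s) • latticePoint (k : Fin d → ℤ)‖) ^ (-p)) ^ 2 := by
            gcongr; exact hφ _
        _ = C ^ 2 * (1 + ‖(2 * Real.pi / s) • latticePoint (k : Fin d → ℤ)‖) ^ (-(2 * p)) :=
          sq_mul_rpow_neg C p (by positivity)
        _ ≤ C ^ 2 * (s⁻¹ * (1 + ‖latticePoint (k : Fin d → ℤ)‖)) ^ (-(2 * p)) := by
          gcongr ?_ * ?_
          exact Real.rpow_le_rpow_of_nonpos (by positivity) hle (by linarith)
        _ = _ := by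
          rw [Real.mul_rpow (by positivity) (by positivity), Real.rpow_neg (by positivity),
            Real.inv_rpow hs0.le, inv_inv, mul_assoc]
    · simpa using! (hs s hs0).subtype {k | k ≠ 0}

end Hat

/-! ### The shift invariant spaces on the Fourier side -/

/-- A dilation multiplies `L²` norms by a constant. The functions need not be measurable. -/
theorem exists_eLpNorm_comp_smul {c : ℝ} (hc : c ≠ 0) :
    ∃ κ : ℝ, 0 < κ ∧ ∀ G : EuclideanSpace ℝ (Fin d) → ℂ,
      eLpNorm (fun x => G (c • x)) 2 volume = ENNReal.ofReal κ * eLpNorm G 2 volume := by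
  have hpos : 0 < |(c ^ Module.finrank ℝ (EuclideanSpace ℝ (Fin d)))⁻¹| := by positivity
  refine ⟨|(c ^ Module.finrank ℝ (EuclideanSpace ℝ (Fin d)))⁻¹| ^ (1 / 2 : ℝ), by positivity,
    fun G => ?_⟩
  have h := (measurableEmbedding_const_smul₀ hc).eLpNorm_map_measure (g := G) (p := 2)
    (μ := (volume : Measure (EuclideanSpace ℝ (Fin d))))
  rw [Measure.map_addHaar_smul volume hc, eLpNorm_smul_measure_of_ne_zero
    (by simpa using hpos)] at h
  rw [← ENNReal.ofReal_rpow_of_pos hpos]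
  simpa [Function.comp_def] using h.symm

section Spaces

variable {φ : EuclideanSpace ℝ (Fin d) → ℂ} {T s : ℝ}

theorem fourier_sum_atomLp (hφ₁ : Integrable φ volume) (hφ₂ : MemLp φ 2 volume) (hT : 0 < T)
    (hs : 0 < s) (F : Finset (Fin d → ℤ)) (c : (Fin d → ℤ) → ℂ) :
    (𝓕 (∑ k ∈ F, c k • atomLp φ T s (-k)) : Lp ℂ 2 volume) =ᵐ[volume] fun ξ =>
      (atomFactor d T : ℂ) *
      ((∑ k ∈ F, c k • mFourier k) (toTorus ((T * s) • ξ)) *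
        scaledHat φ s ((T * s) • ξ)) := by
  classical
  induction F using Finset.induction_on with
  | empty =>
    have : (𝓕 (0 : Lp ℂ 2 (volume : Measure (EuclideanSpace ℝ (Fin d)))) : Lp ℂ 2 volume) = 0 :=
      (Lp.fourierTransformₗᵢ (EuclideanSpace ℝ (Fin d)) ℂ).map_zero
    simp only [Finset.sum_empty, this]
    filter_upwards [Lp.coeFn_zero ℂ 2 (volume : Measure (EuclideanSpace ℝ (Fin d)))] with ξ hξ
    rw [hξ]; simp
  | insert k F hk ih =>
    rw [Finset.sum_insert hk, Finset.sum_insert hk, FourierTransform.fourier_add,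
      FourierTransform.fourier_smul]
    filter_upwards [ih, fourier_atomLp hφ₁ hφ₂ hT hs (-k), Lp.coeFn_add
      (c k • 𝓕 (atomLp φ T s (-k))) (𝓕 (∑ k ∈ F, c k • atomLp φ T s (-k))),
      Lp.coeFn_smul (c k) (𝓕 (atomLp φ T s (-k)))] with ξ h1 h2 h3 h4
    rw [h3, Pi.add_apply, h4, Pi.smul_apply, h1, h2, neg_neg, ContinuousMap.add_apply,
      ContinuousMap.smul_apply, smul_eq_mul, smul_eq_mul]
    ring

theorem range_atomLp_neg : Set.range (fun k => atomLp φ T s (-k)) = Set.range (atomLp φ T s) :=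
  (Equiv.neg (Fin d → ℤ)).surjective.range_comp (atomLp φ T s)

/-- On the Fourier side, a finite combination of atoms is the product of a trigonometric polynomial
and the scaled Fourier transform of `φ`, both dilated. -/
theorem exists_mFourier_of_mem_span (hφ₁ : Integrable φ volume) (hφ₂ : MemLp φ 2 volume)
    (hT : 0 < T) (hs : 0 < s) {w : Lp ℂ 2 (volume : Measure (EuclideanSpace ℝ (Fin d)))}
    (hw : w ∈ Submodule.span ℂ (Set.range (atomLp φ T s))) :
    ∃ q ∈ Submodule.span ℂ (Set.range (mFourier (d := Fin d))), (𝓕 w : Lp ℂ 2 volume) =ᵐ[volume]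
      fun ξ => q (toTorus ((T * s) • ξ)) * scaledHat φ s ((T * s) • ξ) := by
  rw [← range_atomLp_neg, Finsupp.mem_span_range_iff_exists_finsupp] at hw
  obtain ⟨c, rfl⟩ := hw
  refine ⟨(atomFactor d T : ℂ) •
    ∑ k ∈ c.support, c k • mFourier k, Submodule.smul_mem _ _ (Submodule.sum_mem _ fun k _ =>
      Submodule.smul_mem _ _ (Submodule.subset_span (Set.mem_range_self k))), ?_⟩
  filter_upwards [fourier_sum_atomLp hφ₁ hφ₂ hT hs c.support c] with ξ hξ
  rw [Finsupp.sum, hξ, ContinuousMap.smul_apply, smul_eq_mul]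
  exact (mul_assoc _ _ _).symm

/-- Converse of `exists_mFourier_of_mem_span`. -/
theorem exists_mem_span_of_mFourier (hφ₁ : Integrable φ volume) (hφ₂ : MemLp φ 2 volume)
    (hT : 0 < T) (hs : 0 < s) {q : C(UnitAddTorus (Fin d), ℂ)}
    (hq : q ∈ Submodule.span ℂ (Set.range (mFourier (d := Fin d)))) :
    ∃ w ∈ Submodule.span ℂ (Set.range (atomLp φ T s)), (𝓕 w : Lp ℂ 2 volume) =ᵐ[volume]
      fun ξ => q (toTorus ((T * s) • ξ)) * scaledHat φ s ((T * s) • ξ) := by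
  rw [Finsupp.mem_span_range_iff_exists_finsupp] at hq
  obtain ⟨c, rfl⟩ := hq
  have hK : (atomFactor d T : ℂ) ≠ 0 := Complex.ofReal_ne_zero.2 (atomFactor_pos d hT).ne'
  set K := (atomFactor d T : ℂ)
  refine ⟨K⁻¹ • ∑ k ∈ c.support, c k • atomLp φ T s (-k),
    Submodule.smul_mem _ _ (Submodule.sum_mem _ fun k _ =>
      Submodule.smul_mem _ _ (Submodule.subset_span (Set.mem_range_self _))), ?_⟩
  rw [FourierTransform.fourier_smul]
  filter_upwards [fourier_sum_atomLp hφ₁ hφ₂ hT hs c.support c, Lp.coeFn_smul K⁻¹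
    (𝓕 (∑ k ∈ c.support, c k • atomLp φ T s (-k)))] with ξ h1 h2
  rw [h2, Pi.smul_apply, h1, smul_eq_mul, inv_mul_cancel_left₀ hK]
  rfl

theorem enorm_eq_eLpNorm_fourier (f : Lp ℂ 2 (volume : Measure (EuclideanSpace ℝ (Fin d)))) :
    ‖f‖ₑ = eLpNorm (𝓕 f : Lp ℂ 2 volume) 2 volume := by
  rw [← Lp.enorm_def, ← ofReal_norm, ← ofReal_norm, Lp.norm_fourier_eq]

theorem norm_sub_proj_le {w : Lp ℂ 2 (volume : Measure (EuclideanSpace ℝ (Fin d)))}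
    (hw : w ∈ shiftSpace φ T s) (f : Lp ℂ 2 (volume : Measure (EuclideanSpace ℝ (Fin d)))) :
    ‖f - proj φ T s f‖ ≤ ‖f - w‖ := by
  rw [proj, Submodule.starProjection_minimal]
  exact ciInf_le ⟨0, by rintro _ ⟨_, rfl⟩; positivity⟩ (⟨w, hw⟩ : shiftSpace φ T s)

theorem proj_mem (f : Lp ℂ 2 (volume : Measure (EuclideanSpace ℝ (Fin d)))) :
    proj φ T s f ∈ shiftSpace φ T s := Submodule.starProjection_apply_mem _ _

/-- The lower Riesz bound on the Fourier side. The constant absorbs `atomFactor` and the norm `κ` of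
the dilation by `T s`. -/
theorem IsRieszBasis.exists_le (hφ₁ : Integrable φ volume) (hφ₂ : MemLp φ 2 volume)
    (hT : 0 < T) (hs : 0 < s) (h : IsRieszBasis φ T s) :
    ∃ a : ℝ, 0 < a ∧ ∀ q ∈ Submodule.span ℂ (Set.range (mFourier (d := Fin d))),
      ENNReal.ofReal a * ∫⁻ x in unitCell d, ‖q (toTorus x)‖ₑ ^ 2 ≤
        ∫⁻ x, ‖q (toTorus x) * scaledHat φ s x‖ₑ ^ 2 := by
  classical
  obtain ⟨A, B, hA, -, hAB⟩ := h
  obtain ⟨κ, hκ, hκG⟩ := exists_eLpNorm_comp_smul (d := d) (mul_pos hT hs).ne'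
  have hKpos := atomFactor_pos d hT
  set K := atomFactor d T
  refine ⟨A / (K * κ) ^ 2, by positivity, fun q hq => ?_⟩
  rw [Finsupp.mem_span_range_iff_exists_finsupp] at hq
  obtain ⟨c, rfl⟩ := hq
  have hmem : Memℓp (fun k => c (-k)) 2 := by
    refine memℓp_gen (summable_of_hasFiniteSupport ?_)
    refine (c.hasFiniteSupport.preimage neg_injective.injOn).subset fun k hk => ?_
    simp only [Set.mem_preimage, Function.mem_support]
    rintro h0
    exact hk (by simp [h0])
  obtain ⟨-, hlow, -⟩ := hAB ⟨_, hmem⟩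
  have h1 : ∑' k, (⟨_, hmem⟩ : lp (fun _ : Fin d → ℤ => ℂ) 2) k • atomLp φ T s k =
      ∑ k ∈ c.support, c k • atomLp φ T s (-k) := by
    rw [← (Equiv.neg (Fin d → ℤ)).tsum_eq, tsum_eq_sum (s := c.support)]
    · simp
    · intro k hk
      simp [Finsupp.notMem_support_iff.1 hk]
  have h2 : ‖(⟨_, hmem⟩ : lp (fun _ : Fin d → ℤ => ℂ) 2)‖ ^ 2 = ∑ k ∈ c.support, ‖c k‖ ^ 2 := by
    have := lp.norm_rpow_eq_tsum (p := 2) (by simp) (⟨_, hmem⟩ : lp (fun _ : Fin d → ℤ => ℂ) 2)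
    rw [← (Equiv.neg (Fin d → ℤ)).tsum_eq, tsum_eq_sum (s := c.support)] at this
    · simpa using this
    · intro k hk
      simp [Finsupp.notMem_support_iff.1 hk]
  rw [h1, h2] at hlow
  have h3 : ‖∑ k ∈ c.support, c k • atomLp φ T s (-k)‖ₑ = ENNReal.ofReal (K * κ) *
      eLpNorm (fun x => (c.sum fun k a => a • mFourier k) (toTorus x) *
        scaledHat φ s x) 2 volume := by
    rw [enorm_eq_eLpNorm_fourier, eLpNorm_congr_ae (fourier_sum_atomLp hφ₁ hφ₂ hT hs c.support c),
      hκG (fun x => (K : ℂ) * ((∑ k ∈ c.support, c k • mFourier k) (toTorus x) *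
        scaledHat φ s x))]
    rw [show (fun x => (K : ℂ) * ((∑ k ∈ c.support, c k • mFourier k) (toTorus x) *
        scaledHat φ s x)) = (K : ℂ) • fun x =>
        ((∑ k ∈ c.support, c k • mFourier k) (toTorus x) *
        scaledHat φ s x) from rfl, eLpNorm_const_smul,
      ENNReal.ofReal_mul hKpos.le, ← ofReal_norm (K : ℂ), Complex.norm_real,
      Real.norm_of_nonneg hKpos.le]
    rw [← mul_assoc, mul_comm (ENNReal.ofReal κ)]
    rfl
  have h4 : ENNReal.ofReal (A * ∑ k ∈ c.support, ‖c k‖ ^ 2) ≤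
      ‖∑ k ∈ c.support, c k • atomLp φ T s (-k)‖ₑ ^ 2 := by
    rw [← ofReal_norm, ← ENNReal.ofReal_pow (norm_nonneg _)]
    exact ENNReal.ofReal_le_ofReal hlow
  rw [h3, mul_pow, eLpNorm_two_sq, ← ENNReal.ofReal_pow (by positivity),
    ENNReal.ofReal_mul hA.le] at h4
  rw [ENNReal.ofReal_div_of_pos (by positivity), Finsupp.sum, lintegral_unitCell_mFourier,
    ENNReal.mul_comm_div, ← mul_div_assoc]
  exact ENNReal.div_le_of_le_mul' h4

theorem eLpNorm_sub_eq (f w : Lp ℂ 2 (volume : Measure (EuclideanSpace ℝ (Fin d))))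
    {g u : EuclideanSpace ℝ (Fin d) → ℂ} (hf : (𝓕 f : Lp ℂ 2 volume) =ᵐ[volume] g)
    (hw : (𝓕 w : Lp ℂ 2 volume) =ᵐ[volume] u) :
    ‖f - w‖ₑ = eLpNorm (fun x => g x - u x) 2 volume := by
  have h0 : 𝓕 (f - w) = (𝓕 f - 𝓕 w : Lp ℂ 2 volume) :=
    (Lp.fourierTransformₗᵢ (EuclideanSpace ℝ (Fin d)) ℂ).map_sub f w
  rw [enorm_eq_eLpNorm_fourier, h0]
  refine eLpNorm_congr_ae ?_
  filter_upwards [Lp.coeFn_sub (𝓕 f) (𝓕 w), hf, hw] with x h1 h2 h3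
  rw [h1, Pi.sub_apply, h2, h3]

/-- The functions whose Fourier transform is continuous with compact support are dense in `L²`. -/
theorem exists_compactly_supported_fourier
    (f : Lp ℂ 2 (volume : Measure (EuclideanSpace ℝ (Fin d)))) {ε : ℝ} (hε : 0 < ε) :
    ∃ (f' : Lp ℂ 2 (volume : Measure (EuclideanSpace ℝ (Fin d))))
      (g : EuclideanSpace ℝ (Fin d) → ℂ), ‖f - f'‖ ≤ ε ∧ Continuous g ∧ HasCompactSupport g ∧
        (𝓕 f' : Lp ℂ 2 volume) =ᵐ[volume] g := by
  obtain ⟨g, hgc, hg, hgcont, hgLp⟩ := (Lp.memLp (𝓕 f)).exists_hasCompactSupport_eLpNorm_sub_le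
    (by simp) (ε := ENNReal.ofReal ε) (by simpa using hε)
  have h1 : 𝓕 (𝓕⁻ (hgLp.toLp g)) = hgLp.toLp g := FourierTransform.fourier_fourierInv_eq _
  have h2 : (𝓕 (𝓕⁻ (hgLp.toLp g)) : Lp ℂ 2 volume) =ᵐ[volume] g := by
    rw [h1]; exact hgLp.coeFn_toLp
  refine ⟨𝓕⁻ (hgLp.toLp g), g, ?_, hgcont, hgc, h2⟩
  have h3 := eLpNorm_sub_eq f (𝓕⁻ (hgLp.toLp g)) (g := (𝓕 f : Lp ℂ 2 volume))
    (ae_eq_refl _) h2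
  rw [← ENNReal.ofReal_le_ofReal_iff hε.le, ofReal_norm, h3]
  exact hg

end Spaces

/-! ### The limit of small scales -/

section Limit

variable {φ : EuclideanSpace ℝ (Fin d) → ℂ} {p C s : ℝ}

/-- When the Fourier transform of `f` is compactly supported, dilation by `T s` moves its support
into any ball about `0`, where the bounds for functions supported near the origin apply. -/
theorem tendsto_norm_sub_proj_of_compactSupport (hφ₁ : Integrable φ volume)
    (hφ₂ : MemLp φ 2 volume) (hp : (d : ℝ) / 2 < p) (hs : 0 < s)
    (hψ : ∀ x, ‖scaledHat φ s x‖ ≤ C * (1 + ‖x‖) ^ (-p))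
    (hsum : Summable (fourierSample φ s)) (hpos : 0 < ∑' k : Fin d → ℤ, fourierSample φ s k)
    {f : Lp ℂ 2 (volume : Measure (EuclideanSpace ℝ (Fin d)))}
    {g : EuclideanSpace ℝ (Fin d) → ℂ} (hgc : Continuous g) (hgs : HasCompactSupport g)
    (hfg : (𝓕 f : Lp ℂ 2 volume) =ᵐ[volume] g) :
    Tendsto (fun T => ‖f - proj φ T s f‖) (𝓝[>] 0) (𝓝 (√(saturation φ s) * ‖f‖)) := by
  have hψc := continuous_scaledHat hφ₁ s
  rw [tsum_fourierSample hsum] at hpos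
  have hsat := saturation_eq hsum
  set ψ : EuclideanSpace ℝ (Fin d) → ℂ := scaledHat φ s
  obtain ⟨ρ, hρ, hρg⟩ : ∃ ρ : ℝ, 0 < ρ ∧ ∀ x, ρ ≤ ‖x‖ → g x = 0 := by
    obtain ⟨ρ, hρ, h⟩ := hgs.isCompact.isBounded.exists_pos_norm_lt
    refine ⟨ρ, hρ, fun x hx => ?_⟩
    by_contra h0
    exact absurd (h x (subset_tsupport _ h0)) (not_lt.2 hx)
  -- The dilated transform of `f` is supported in an arbitrarily small ball once `T` is small.
  have hsmall : ∀ δ > 0, ∀ᶠ T : ℝ in 𝓝[>] 0, 0 < T ∧ ∀ x, δ ≤ ‖x‖ → g ((T * s)⁻¹ • x) = 0 := by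
    intro δ hδ
    filter_upwards [Ioo_mem_nhdsGT (show (0 : ℝ) < δ / (s * ρ) by positivity)] with T hT
    refine ⟨hT.1, fun x hx => hρg _ ?_⟩
    have hTs : 0 < T * s := mul_pos hT.1 hs
    rw [norm_smul, norm_inv, Real.norm_of_nonneg hTs.le, ← div_eq_inv_mul, le_div_iff₀ hTs]
    have := (lt_div_iff₀ (by positivity)).1 hT.2
    linarith
  have hscale : ∀ T : ℝ, 0 < T → ∀ q : C(UnitAddTorus (Fin d), ℂ),
      (fun ξ => g ξ - q (toTorus ((T * s) • ξ)) * ψ ((T * s) • ξ)) = fun ξ =>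
        (fun x => g ((T * s)⁻¹ • x) - q (toTorus x) * ψ x) ((T * s) • ξ) := by
    intro T hT q
    ext ξ
    simp only [inv_smul_smul₀ (mul_pos hT hs).ne']
  have hnorm : ∀ T : ℝ, 0 < T → ∀ κ : ℝ, (∀ G : EuclideanSpace ℝ (Fin d) → ℂ,
      eLpNorm (fun x => G ((T * s) • x)) 2 volume = ENNReal.ofReal κ * eLpNorm G 2 volume) →
      ‖f‖ₑ = ENNReal.ofReal κ * eLpNorm (fun x => g ((T * s)⁻¹ • x)) 2 volume := by
    intro T hT κ hκ
    rw [enorm_eq_eLpNorm_fourier, eLpNorm_congr_ae hfg, ← hκ]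
    simp only [inv_smul_smul₀ (mul_pos hT hs).ne']
  have hlower : ∀ ε > 0, ∀ᶠ T : ℝ in 𝓝[>] 0,
      (√(saturation φ s) - ε) * ‖f‖ ≤ ‖f - proj φ T s f‖ := by
    intro ε hε
    obtain ⟨δ, hδ, H⟩ := exists_le_eLpNorm_sub hψc hp hψ hpos hε
    filter_upwards [hsmall δ hδ] with T ⟨hT, hTδ⟩
    obtain ⟨κ, hκ, hκG⟩ := exists_eLpNorm_comp_smul (d := d) (mul_pos hT hs).ne'
    have hspan : ∀ w ∈ Submodule.span ℂ (Set.range (atomLp φ T s)),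
        (√(saturation φ s) - ε) * ‖f‖ ≤ ‖f - w‖ := by
      intro w hw
      obtain ⟨q, -, hqw⟩ := exists_mFourier_of_mem_span hφ₁ hφ₂ hT hs hw
      have h1 := H (fun x => g ((T * s)⁻¹ • x)) (by fun_prop) hTδ q q.continuous.measurable
      have h2 := eLpNorm_sub_eq f w hfg hqw
      rw [hscale T hT q, hκG (fun x => g ((T * s)⁻¹ • x) - q (toTorus x) * ψ x)] at h2
      rw [← ENNReal.ofReal_le_ofReal_iff (norm_nonneg _), ENNReal.ofReal_mul' (norm_nonneg _),
        ofReal_norm, ofReal_norm, h2, hnorm T hT κ hκG, hsat, mul_left_comm]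
      gcongr
    have hclosed : IsClosed {w : Lp ℂ 2 (volume : Measure (EuclideanSpace ℝ (Fin d))) |
        (√(saturation φ s) - ε) * ‖f‖ ≤ ‖f - w‖} :=
      isClosed_le continuous_const (by fun_prop)
    exact closure_minimal hspan hclosed (proj_mem (φ := φ) (T := T) (s := s) f)
  have hupper : ∀ ε > 0, ∀ᶠ T : ℝ in 𝓝[>] 0,
      ‖f - proj φ T s f‖ ≤ (√(saturation φ s) + ε) * ‖f‖ := by
    intro ε hε
    obtain ⟨δ, hδ, H⟩ := exists_eLpNorm_sub_le hψc hp hψ hpos hε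
    filter_upwards [hsmall δ hδ] with T ⟨hT, hTδ⟩
    obtain ⟨κ, hκ, hκG⟩ := exists_eLpNorm_comp_smul (d := d) (mul_pos hT hs).ne'
    refine le_of_forall_pos_le_add fun η hη => ?_
    obtain ⟨q, hq, h1⟩ := H (fun x => g ((T * s)⁻¹ • x)) (by fun_prop) hTδ
      (ENNReal.ofReal (η / κ)) (by simpa using div_pos hη hκ)
    obtain ⟨w, hw, hqw⟩ := exists_mem_span_of_mFourier hφ₁ hφ₂ hT hs hq
    have h2 := eLpNorm_sub_eq f w hfg hqw
    rw [hscale T hT q, hκG (fun x => g ((T * s)⁻¹ • x) - q (toTorus x) * ψ x)] at h2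
    refine (norm_sub_proj_le (Submodule.le_topologicalClosure _ hw) f).trans ?_
    have h3 : 0 ≤ √(saturation φ s) + ε := by positivity
    rw [← ENNReal.ofReal_le_ofReal_iff (by positivity), ENNReal.ofReal_add (by positivity) hη.le,
      ENNReal.ofReal_mul h3, ofReal_norm, ofReal_norm, h2, hnorm T hT κ hκG, hsat,
      mul_left_comm]
    refine (mul_le_mul' le_rfl h1).trans_eq ?_
    rw [mul_add, ← ENNReal.ofReal_mul hκ.le, mul_div_cancel₀ _ hκ.ne']
  rw [Metric.tendsto_nhds]
  intro ε hε
  have hε' : 0 < ε / (‖f‖ + 1) := by positivity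
  filter_upwards [hlower _ hε', hupper _ hε'] with T h1 h2
  have h3 : ε / (‖f‖ + 1) * ‖f‖ < ε := by
    rw [div_mul_eq_mul_div, div_lt_iff₀ (by positivity)]
    nlinarith
  rw [Real.dist_eq, abs_lt]
  constructor <;> nlinarith

/-- The relative distance from every `f ∈ L²` to the shift invariant space tends to the square root
of the saturation error. It suffices to treat a dense set, as the distance is `1`-Lipschitz in `f`,
uniformly in `T`. -/
theorem tendsto_norm_sub_proj (hφ₁ : Integrable φ volume)
    (hφ₂ : MemLp φ 2 volume) (hp : (d : ℝ) / 2 < p) (hs : 0 < s)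
    (hψ : ∀ x, ‖scaledHat φ s x‖ ≤ C * (1 + ‖x‖) ^ (-p))
    (hsum : Summable (fourierSample φ s)) (hpos : 0 < ∑' k : Fin d → ℤ, fourierSample φ s k)
    (f : Lp ℂ 2 (volume : Measure (EuclideanSpace ℝ (Fin d)))) :
    Tendsto (fun T => ‖f - proj φ T s f‖) (𝓝[>] 0) (𝓝 (√(saturation φ s) * ‖f‖)) := by
  rw [Metric.tendsto_nhds]
  intro ε hε
  obtain ⟨f', g, hff', hgc, hgs, hfg⟩ := exists_compactly_supported_fourier f
    (show 0 < ε / 4 by positivity)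
  have h1 := tendsto_norm_sub_proj_of_compactSupport hφ₁ hφ₂ hp hs hψ hsum hpos hgc hgs hfg
  filter_upwards [Metric.tendsto_nhds.1 h1 (ε / 4) (by positivity)] with T hT
  have h2 : |‖f - proj φ T s f‖ - ‖f' - proj φ T s f'‖| ≤ ε / 4 := by
    refine (abs_norm_sub_norm_le _ _).trans (le_trans ?_ hff')
    have h3 : f - proj φ T s f - (f' - proj φ T s f') = (f - f') - proj φ T s (f - f') := by
      rw [map_sub]; abel
    rw [h3]
    simpa using norm_sub_proj_le (φ := φ) (T := T) (s := s) (Submodule.zero_mem _) (f - f')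
  have h4 : |√(saturation φ s) * ‖f'‖ - √(saturation φ s) * ‖f‖| ≤ ε / 4 := by
    rw [← mul_sub, abs_mul, abs_of_nonneg (Real.sqrt_nonneg _), abs_sub_comm]
    have h5 : √(saturation φ s) ≤ 1 := Real.sqrt_le_one.2 (saturation_le_one hsum)
    calc _ ≤ 1 * (ε / 4) := mul_le_mul h5 ((abs_norm_sub_norm_le _ _).trans hff')
          (abs_nonneg _) zero_le_one
      _ = _ := one_mul _
  rw [Real.dist_eq] at hT ⊢
  rw [abs_le] at h2 h4
  rw [abs_lt] at hT ⊢
  constructor <;> linarith [h2.1, h2.2, h4.1, h4.2, hT.1, hT.2]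

end Limit

end ShiftInvariant

end

open ShiftInvariant in
theorem theorem3p5 {d : ℕ} (φ : EuclideanSpace ℝ (Fin d) → ℂ)
    (hφ₁ : Integrable φ volume) (hφ₂ : MemLp φ 2 volume)
    (p : ℝ) (hp : (d : ℝ) / 2 < p)
    (hdecay : ShiftInvariant.fourierHat φ
      =O[Bornology.cobounded (EuclideanSpace ℝ (Fin d))] fun ξ => ‖ξ‖ ^ (-p)) :
    (∀ s : ℝ, 0 < s → Summable (ShiftInvariant.fourierSample φ s)) ∧
    (∀ T₀ s : ℝ, 0 < T₀ → 0 < s → ShiftInvariant.IsRieszBasis φ T₀ s →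
      0 < ∑' k : Fin d → ℤ, ShiftInvariant.fourierSample φ s k ∧
      ∀ (r : ℝ) (f : Lp ℂ 2 (volume : Measure (EuclideanSpace ℝ (Fin d)))),
        (d : ℝ) / 2 < r →
        TemperedDistribution.MemSobolev r 2 (f : 𝓢'(EuclideanSpace ℝ (Fin d), ℂ)) →
        Tendsto (fun T : ℝ => ‖ShiftInvariant.proj φ T s f - f‖ ^ 2) (𝓝[>] 0)
          (𝓝 (ShiftInvariant.saturation φ s * ‖f‖ ^ 2))) ∧
    (ShiftInvariant.fourierHat φ 0 ≠ 0 →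
      Tendsto (ShiftInvariant.saturation φ) (𝓝[>] 0) (𝓝 0)) := by
  have hp0 : 0 < p := lt_of_le_of_lt (by positivity) hp
  obtain ⟨C, hC⟩ := exists_decay_bound (continuous_fourierHat hφ₁) hp0 hdecay
  have hsum : ∀ s : ℝ, 0 < s → Summable (fourierSample φ s) := by
    intro s hs
    obtain ⟨C', hC'⟩ := exists_dilate_bound hp0 hC (show 0 < 2 * Real.pi / s by positivity)
    simpa using! summable_sq_norm_add_latticePoint (x := 0)
      (ψ := scaledHat φ s) hp hC' (by simp)
  refine ⟨hsum, fun T₀ s hT₀ hs hR => ?_, tendsto_saturation hp hC hsum⟩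
  obtain ⟨C', hC'⟩ := exists_dilate_bound hp0 hC (show 0 < 2 * Real.pi / s by positivity)
  obtain ⟨a, ha, haq⟩ := hR.exists_le hφ₁ hφ₂ hT₀ hs
  have hpos : 0 < ∑' k : Fin d → ℤ, fourierSample φ s k := by
    rw [tsum_fourierSample (hsum s hs)]
    exact total_energy_pos (continuous_scaledHat hφ₁ s) hp hC' ha haq
  refine ⟨hpos, fun r f _ _ => ?_⟩
  have h2 := (tendsto_norm_sub_proj hφ₁ hφ₂ hp hs hC' (hsum s hs) hpos f).pow 2
  rw [mul_pow, Real.sq_sqrt (saturation_nonneg (hsum s hs))] at h2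
  simpa only [norm_sub_rev] using h2
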